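/- **Setting.** Let $\mu$ be the surface measure on the unit sphere $\mathbb S^2\subset\mathbb R^3$ (so $\mu(\mathbb S^2)=4\pi$), and let $\mathbf L_2(\mathbb S^2)$ be the space of square-integrable tangential vector fields with $\langle \mathbf f,\mathbf g\rangle=\int_{\mathbb S^2}\mathbf f^\top\mathbf g\,d\mu$. With $\nabla_*=(\mathbf I-xx^\top)\nabla$ and $\mathbf L_*=x\times\nabla$ the surface gradient and surface curl, let $\{Y_{\ell,k}\}_{k=1}^{2\ell+1}$ be a real $L_2$-orthonormal basis of the spherical harmonics of degree $\ell$, $\lambda_\ell=\ell(\ell+1)$, and $$\mathbf y_{\ell,k}=\lambda_\ell^{-1/2}\,\mathbf L_*Y_{\ell,k},\qquad \mathbf z_{\ell,k}=\lambda_\ell^{-1/2}\,\nabla_*Y_{\ell,k}\qquad(\ell\ge1).$$ For real $\sigma\ge0$, $\mathbf H^\sigma(\mathbb S^2)$ is the set of $\mathbf f\in\mathbf L_2(\mathbb S^2)$ with $$\|\mathbf f\|_{\mathbf H^\sigma}^2=\sum_{\ell\ge1}\sum_{k=1}^{2\ell+1}(1+\lambda_\ell)^\sigma\left(|\langle\mathbf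 f,\mathbf y_{\ell,k}\rangle|^2+|\langle\mathbf f,\mathbf z_{\ell,k}\rangle|^2\right)<\infty .$$ For $\mathbf g\in\mathbf L_2(\mathbb S^2)$ let $\mathbf g_{\mathrm{div}}$ and $\mathbf g_{\mathrm{curl}}$ be its orthogonal projections onto the subspaces of (weakly) divergence-free fields, $\{\mathbf f\in\mathbf L_2(\mathbb S^2):\langle\mathbf f,\nabla_*g\rangle=0\ \ \forall g\in C^\infty\}$, and of (weakly) curl-free fields, $\{\mathbf f\in\mathbf L_2(\mathbb S^2):\langle\mathbf f,\mathbf L_*g\rangle=0\ \ \forall g\in C^\infty\}$. **Kernels.** Let $\phi\in C[0,\infty)$ and, for every $0<\rho<1$, let $C_{\psi,\rho}$ be a constant such that the zonal kernel $\psi_\rho(x\cdot y)=C_{\psi,\rho}\,\phi(\rho^{-1}\|x-y\|)$, that is $\psi_\rho(t)=C_{\psi,\rho}\,\phi(\rho^{-1}\sqrt{2-2t})$, satisfies $\int_{\mathbb S^2}\psi_\rho(x\cdot y)\,d\mu(x)=1$ for all $y\in\mathbb S^2$. Put $\widehat\psi_\rho(\ell)=2\pi\int_{-1}^1\psi_\rho(t)P_\ell(t)\,dt$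 with $P_\ell$ the Legendre polynomials. Assume that there are $0<\rho_0<1$, $m\ge0$ and $c_1,c_2>0$ such that, with $\ell_\rho=\lfloor\rho^{-1}-1\rfloor$, $$|1-\widehat\psi_\rho(\ell)|\le c_1(\ell\rho)^m\quad(0<\rho<\rho_0,\ 0\le\ell\le\ell_\rho),\qquad |\widehat\psi_\rho(\ell)|\le c_2\quad(0<\rho<1,\ \ell>\ell_\rho).$$ With $$\kappa_\rho(t)=\frac1{4\pi(1-t^2)}\int_{-1}^t(1-4\pi\psi_\rho(s))\,ds ,\qquad t=x\cdot y ,$$ define, for $x,y\in\mathbb S^2$ with $x\ne\pm y$, $$\Psi^{\mathrm{div}}_\rho(x,y)=-\kappa_\rho'(t)(x\times y)(x\times y)^\top+\kappa_\rho(t)(t\mathbf I-yx^\top),$$ $$\Psi^{\mathrm{curl}}_\rho(x,y)=\kappa_\rho'(t)(y-tx)(x-ty)^\top+\kappa_\rho(t)(\mathbf I-xx^\top)(\mathbf I-yy^\top),$$ and $$\mathcal C_{\Psi_\rho}\mathbf f(x)=\int_{\mathbb S^2}\left(\Psi^{\mathrm{div}}_\rho(x,y)+\Psi^{\mathrm{curl}}_\rho(x,y)\right)\mathbf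 f(y)\,d\mu(y).$$ **Claim.** Let $0\le\tau\le\sigma\le m$. Then there is a constant $C>0$, independent of $\rho$ and $\mathbf f$, such that for all $0<\rho<1$ and all $\mathbf f\in\mathbf H^\sigma(\mathbb S^2)$ one has $\mathcal C_{\Psi_\rho}\mathbf f\in\mathbf L_2(\mathbb S^2)$ and $$\|\mathbf f_{\mathrm{div}}-(\mathcal C_{\Psi_\rho}\mathbf f)_{\mathrm{div}}\|_{\mathbf H^\tau(\mathbb S^2)}\le C\rho^{\sigma-\tau}\|\mathbf f\|_{\mathbf H^\sigma(\mathbb S^2)},\qquad \|\mathbf f_{\mathrm{curl}}-(\mathcal C_{\Psi_\rho}\mathbf f)_{\mathrm{curl}}\|_{\mathbf H^\tau(\mathbb S^2)}\le C\rho^{\sigma-\tau}\|\mathbf f\|_{\mathbf H^\sigma(\mathbb S^2)}.$$ -/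

import Mathlib

open MeasureTheory Set
open scoped ContDiff ENNReal RealInnerProductSpace

noncomputable section

/-! ### The sphere, square-integrable fields, surface differential operators -/

/-- Euclidean three-space. -/
abbrev E3 : Type := EuclideanSpace ℝ (Fin 3)

/-- The unit sphere of `ℝ³`. -/
abbrev S2 : Type := Metric.sphere (0 : E3) 1

/-- The rotation invariant surface measure on the sphere, of total mass `4π`. -/
abbrev surfaceMeasure : Measure S2 := (volume : Measure E3).toSphere

/-- Square-integrable `ℝ³`-valued fields on the sphere (not necessarily tangential). -/
abbrev L2Field : Type := Lp E3 2 surfaceMeasure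

/-- The cross product `x × y` of `ℝ³`. -/
def cross (x y : E3) : E3 := WithLp.toLp 2 (crossProduct x.ofLp y.ofLp)

/-- The surface gradient `(I - x xᵀ) ∇F(x)` at `x ∈ S²` of a function defined near the sphere. -/
def surfaceGradient (F : E3 → ℝ) (x : E3) : E3 :=
  gradient F x - ⟪x, gradient F x⟫ • x

/-- The surface curl `x × ∇F(x)` at `x ∈ S²` of a function defined near the sphere. -/
def surfaceCurl (F : E3 → ℝ) (x : E3) : E3 :=
  cross x (gradient F x)

lemma continuous_cross {X : Type*} [TopologicalSpace X] {u v : X → E3}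
    (hu : Continuous u) (hv : Continuous v) : Continuous fun x => cross (u x) (v x) := by
  unfold cross
  simp only [cross_apply]
  refine (PiLp.continuous_toLp 2 (fun _ : Fin 3 => ℝ)).comp (continuous_pi fun i => ?_)
  fin_cases i <;> simp <;> fun_prop

lemma continuous_gradient {g : E3 → ℝ} (hg : ContDiff ℝ ∞ g) : Continuous (gradient g) := by
  unfold gradient
  exact (LinearIsometryEquiv.continuous _).comp (hg.continuous_fderiv (by simp))

lemma continuous_surfaceGradient {g : E3 → ℝ} (hg : ContDiff ℝ ∞ g) :
    Continuous fun x : S2 => surfaceGradient g x := by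
  have h := continuous_gradient hg
  unfold surfaceGradient
  fun_prop

lemma continuous_surfaceCurl {g : E3 → ℝ} (hg : ContDiff ℝ ∞ g) :
    Continuous fun x : S2 => surfaceCurl g x := by
  have h := continuous_gradient hg
  exact continuous_cross continuous_subtype_val (h.comp continuous_subtype_val)

lemma memLp_of_continuous {G : S2 → E3} (hG : Continuous G) : MemLp G 2 surfaceMeasure := by
  obtain ⟨C, hC⟩ := isCompact_univ.exists_bound_of_continuousOn hG.continuousOn
  exact MemLp.of_bound hG.aestronglyMeasurable C (Filter.Eventually.of_forall fun x => hC x trivial)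

lemma integral_inner_eq (f : L2Field) {G : S2 → E3} (hG : Continuous G) :
    ∫ x, ⟪f x, G x⟫ ∂surfaceMeasure = ⟪f, (memLp_of_continuous hG).toLp G⟫ := by
  rw [L2.inner_def]
  refine integral_congr_ae ?_
  filter_upwards [(memLp_of_continuous hG).coeFn_toLp] with x hx
  rw [hx]

/-- The space `𝐋₂(S²)` of square-integrable tangential vector fields. -/
def tangentialL2 : Submodule ℝ L2Field where
  carrier := {f | ∀ᵐ x : S2 ∂surfaceMeasure, ⟪(x : E3), f x⟫ = 0}
  zero_mem' := by
    filter_upwards [Lp.coeFn_zero E3 2 surfaceMeasure] with x hx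
    rw [hx, Pi.zero_apply, inner_zero_right]
  add_mem' := by
    intro f g hf hg
    filter_upwards [hf, hg, Lp.coeFn_add f g] with x h1 h2 h3
    rw [h3, Pi.add_apply, inner_add_right, h1, h2, add_zero]
  smul_mem' := by
    intro c f hf
    filter_upwards [hf, Lp.coeFn_smul c f] with x h1 h2
    rw [h2, Pi.smul_apply, inner_smul_right, h1, mul_zero]

lemma isClosed_tangentialL2 : IsClosed (tangentialL2 : Set L2Field) := by
  refine IsSeqClosed.isClosed fun u f hu hf => ?_
  obtain ⟨ns, -, hns⟩ :=
    (tendstoInMeasure_of_tendsto_Lp hf).exists_seq_tendsto_ae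
  have hall : ∀ᵐ x : S2 ∂surfaceMeasure, ∀ n, ⟪(x : E3), u n x⟫ = 0 := ae_all_iff.2 hu
  change ∀ᵐ x : S2 ∂surfaceMeasure, ⟪(x : E3), f x⟫ = 0
  filter_upwards [hns, hall] with x h1 h2
  have h3 := (tendsto_const_nhds (x := (x : E3))).inner (𝕜 := ℝ) h1
  simp only [h2] at h3
  exact (tendsto_nhds_unique h3 tendsto_const_nhds)

/-! ### The Helmholtz–Hodge decomposition -/

/-- The tangential fields of `tangentialL2` that are orthogonal to `D g` for every smooth `g`. -/
def weakKernel (D : (E3 → ℝ) → E3 → E3)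
    (hD : ∀ g, ContDiff ℝ ∞ g → Continuous fun x : S2 => D g x) : Submodule ℝ L2Field where
  carrier := {f | f ∈ tangentialL2 ∧
    ∀ g : E3 → ℝ, ContDiff ℝ ∞ g → ∫ x, ⟪f x, D g x⟫ ∂surfaceMeasure = 0}
  zero_mem' := by
    refine ⟨tangentialL2.zero_mem, fun g hg => ?_⟩
    rw [integral_inner_eq _ (hD g hg), inner_zero_left]
  add_mem' := by
    rintro f f' ⟨hf, hf'⟩ ⟨hg, hg'⟩
    refine ⟨tangentialL2.add_mem hf hg, fun g h => ?_⟩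
    have h1 := hf' g h
    have h2 := hg' g h
    rw [integral_inner_eq _ (hD g h)] at h1 h2 ⊢
    rw [inner_add_left, h1, h2, add_zero]
  smul_mem' := by
    rintro c f ⟨hf, hf'⟩
    refine ⟨tangentialL2.smul_mem c hf, fun g h => ?_⟩
    have h1 := hf' g h
    rw [integral_inner_eq _ (hD g h)] at h1 ⊢
    rw [inner_smul_left, h1, mul_zero]

lemma isClosed_weakKernel (D : (E3 → ℝ) → E3 → E3)
    (hD : ∀ g, ContDiff ℝ ∞ g → Continuous fun x : S2 => D g x) :
    IsClosed (weakKernel D hD : Set L2Field) := by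
  have h : (weakKernel D hD : Set L2Field) = (tangentialL2 : Set L2Field) ∩
      ⋂ (g : E3 → ℝ) (hg : ContDiff ℝ ∞ g),
        {f : L2Field | ⟪f, (memLp_of_continuous (hD g hg)).toLp _⟫ = 0} := by
    ext f
    simp only [mem_inter_iff, mem_iInter, mem_ofPred_eq]
    refine and_congr Iff.rfl (forall₂_congr fun g hg => ?_)
    rw [integral_inner_eq f (hD g hg)]
  rw [h]
  refine isClosed_tangentialL2.inter (isClosed_iInter fun g => isClosed_iInter fun hg => ?_)
  exact isClosed_eq (by fun_prop) continuous_const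

/-- The divergence-free subspace of `𝐋₂(S²)`: the tangential `f` whose surface divergence vanishes
in the weak sense, `∫ f · ∇⁎g dμ = 0` for all smooth `g`. -/
def divFree : Submodule ℝ L2Field :=
  weakKernel surfaceGradient fun _ hg => continuous_surfaceGradient hg

/-- The curl-free subspace of `𝐋₂(S²)`: the tangential `f` whose surface (scalar) curl vanishes
in the weak sense, `∫ f · 𝐋⁎g dμ = 0` for all smooth `g`. -/
def curlFree : Submodule ℝ L2Field :=
  weakKernel surfaceCurl fun _ hg => continuous_surfaceCurl hg

instance : CompleteSpace divFree := (isClosed_weakKernel _ _).completeSpace_coe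

instance : CompleteSpace curlFree := (isClosed_weakKernel _ _).completeSpace_coe

/-- The divergence-free component `f_div`: orthogonal projection onto the divergence-free fields. -/
def divPart (f : L2Field) : L2Field := divFree.starProjection f

/-- The curl-free component `f_curl`: orthogonal projection onto the curl-free fields. -/
def curlPart (f : L2Field) : L2Field := curlFree.starProjection f

/-! ### Scalar and vector spherical harmonics, Sobolev norms -/

/-- The Laplacian on polynomials in three variables. -/
def polyLaplacian : MvPolynomial (Fin 3) ℝ →ₗ[ℝ] MvPolynomial (Fin 3) ℝ :=
  ∑ i : Fin 3, (MvPolynomial.pderiv i).toLinearMap ∘ₗ (MvPolynomial.pderiv i).toLinearMap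

/-- Harmonic homogeneous polynomials of degree `ℓ`; their restrictions to the sphere are the
spherical harmonics of degree `ℓ`. -/
def harmonicSpace (ℓ : ℕ) : Submodule ℝ (MvPolynomial (Fin 3) ℝ) :=
  MvPolynomial.homogeneousSubmodule (Fin 3) ℝ ℓ ⊓ LinearMap.ker polyLaplacian

/-- A polynomial as a function on `ℝ³`. -/
def polyFun (p : MvPolynomial (Fin 3) ℝ) (x : E3) : ℝ := MvPolynomial.eval x.ofLp p

/-- `Y ℓ 0, …, Y ℓ (2ℓ)` is, for every degree `ℓ`, a real basis of the spherical harmonics of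
degree `ℓ` that is orthonormal in `L₂(S²)`. -/
structure IsSphericalHarmonicBasis
    (Y : (ℓ : ℕ) → Fin (2 * ℓ + 1) → MvPolynomial (Fin 3) ℝ) : Prop where
  span_eq : ∀ ℓ, Submodule.span ℝ (Set.range (Y ℓ)) = harmonicSpace ℓ
  orthonormal : ∀ ℓ k k', ∫ x : S2, polyFun (Y ℓ k) x * polyFun (Y ℓ k') x ∂surfaceMeasure =
    if k = k' then 1 else 0

/-- The divergence-free vector spherical harmonic `𝐋⁎Y / √(ℓ(ℓ+1))`. -/
def vecY (ℓ : ℕ) (p : MvPolynomial (Fin 3) ℝ) (x : E3) : E3 :=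
  (√((ℓ : ℝ) * (ℓ + 1)))⁻¹ • surfaceCurl (polyFun p) x

/-- The curl-free vector spherical harmonic `∇⁎Y / √(ℓ(ℓ+1))`. -/
def vecZ (ℓ : ℕ) (p : MvPolynomial (Fin 3) ℝ) (x : E3) : E3 :=
  (√((ℓ : ℝ) * (ℓ + 1)))⁻¹ • surfaceGradient (polyFun p) x

/-- The Fourier–Legendre coefficient `⟨f, 𝐲_{ℓ,k}⟩`. -/
def divCoeff (Y : (ℓ : ℕ) → Fin (2 * ℓ + 1) → MvPolynomial (Fin 3) ℝ) (f : L2Field)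
    (ℓ : ℕ) (k : Fin (2 * ℓ + 1)) : ℝ :=
  ∫ x, ⟪f x, vecY ℓ (Y ℓ k) x⟫ ∂surfaceMeasure

/-- The Fourier–Legendre coefficient `⟨f, 𝐳_{ℓ,k}⟩`. -/
def curlCoeff (Y : (ℓ : ℕ) → Fin (2 * ℓ + 1) → MvPolynomial (Fin 3) ℝ) (f : L2Field)
    (ℓ : ℕ) (k : Fin (2 * ℓ + 1)) : ℝ :=
  ∫ x, ⟪f x, vecZ ℓ (Y ℓ k) x⟫ ∂surfaceMeasure

/-- The norm `‖f‖_{𝐇^σ(S²)}`, with value `⊤` if the defining series diverges. -/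
def sobolevNorm (Y : (ℓ : ℕ) → Fin (2 * ℓ + 1) → MvPolynomial (Fin 3) ℝ) (σ : ℝ)
    (f : L2Field) : ℝ≥0∞ :=
  (∑' ℓ : {ℓ : ℕ // 1 ≤ ℓ}, ∑ k : Fin (2 * (ℓ : ℕ) + 1),
    ENNReal.ofReal ((1 + (ℓ : ℝ) * ((ℓ : ℝ) + 1)) ^ σ *
      (divCoeff Y f ℓ k ^ 2 + curlCoeff Y f ℓ k ^ 2))) ^ (1 / 2 : ℝ)

/-- Membership in `𝐇^σ(S²)`. -/
def MemSobolev (Y : (ℓ : ℕ) → Fin (2 * ℓ + 1) → MvPolynomial (Fin 3) ℝ) (σ : ℝ)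
    (f : L2Field) : Prop :=
  f ∈ tangentialL2 ∧ sobolevNorm Y σ f < ⊤

/-! ### Zonal kernels and the matrix-valued kernels -/

/-- The Legendre polynomial `P_ℓ` (with `P_ℓ(1) = 1`), by Rodrigues' formula. -/
def legendreP (ℓ : ℕ) : Polynomial ℝ :=
  Polynomial.C ((2 ^ ℓ * (ℓ.factorial : ℝ))⁻¹) *
    Polynomial.derivative^[ℓ] ((Polynomial.X ^ 2 - 1) ^ ℓ)

/-- The Fourier–Legendre coefficient `ψ̂(ℓ)` of a zonal kernel, normalised so that
`ψ = ∑ (2ℓ+1)/(4π) ψ̂(ℓ) P_ℓ`. -/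
def legendreCoeff (ψ : ℝ → ℝ) (ℓ : ℕ) : ℝ :=
  2 * Real.pi * ∫ t in (-1 : ℝ)..1, ψ t * (legendreP ℓ).eval t

/-- The scaled zonal kernel `ψ_ρ(t) = c φ(ρ⁻¹ √(2 - 2t))`; note `‖x - y‖ = √(2 - 2 x·y)` for unit
vectors. -/
def scaledKernel (φ : ℝ → ℝ) (c ρ : ℝ) (t : ℝ) : ℝ := c * φ (ρ⁻¹ * √(2 - 2 * t))

/-- The assumption on the scaled kernels: near-identity for low degrees, boundedness for high
degrees. -/
structure KernelAssumption (ψ : ℝ → ℝ → ℝ) (ρ₀ m c₁ c₂ : ℝ) : Prop where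
  low : ∀ ρ : ℝ, 0 < ρ → ρ < ρ₀ → ∀ ℓ : ℕ, ℓ ≤ ⌊ρ⁻¹ - 1⌋₊ →
    |1 - legendreCoeff (ψ ρ) ℓ| ≤ c₁ * ((ℓ : ℝ) * ρ) ^ m
  high : ∀ ρ : ℝ, 0 < ρ → ρ < 1 → ∀ ℓ : ℕ, ⌊ρ⁻¹ - 1⌋₊ < ℓ → |legendreCoeff (ψ ρ) ℓ| ≤ c₂

/-- The auxiliary function `κ(t) = (4π(1-t²))⁻¹ ∫_{-1}^t (1 - 4πψ(s)) ds`. -/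
def kappa (ψ : ℝ → ℝ) (t : ℝ) : ℝ :=
  (4 * Real.pi * (1 - t ^ 2))⁻¹ * ∫ s in (-1 : ℝ)..t, (1 - 4 * Real.pi * ψ s)

/-- The divergence-free kernel `κ'(t) 𝐐 + κ(t) 𝐑` with `t = x·y`, `𝐐 = -(x×y)(x×y)ᵀ`,
`𝐑 = t I - y xᵀ`. -/
def divKernel (ψ : ℝ → ℝ) (x y : E3) : Matrix (Fin 3) (Fin 3) ℝ :=
  deriv (kappa ψ) ⟪x, y⟫ • (-Matrix.vecMulVec (cross x y).ofLp (cross x y).ofLp) +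
    kappa ψ ⟪x, y⟫ • (⟪x, y⟫ • (1 : Matrix (Fin 3) (Fin 3) ℝ) - Matrix.vecMulVec y.ofLp x.ofLp)

/-- The curl-free kernel `κ'(t) 𝐕 + κ(t) 𝐖` with `t = x·y`, `𝐕 = (y - t x)(x - t y)ᵀ`,
`𝐖 = (I - x xᵀ)(I - y yᵀ)`. -/
def curlKernel (ψ : ℝ → ℝ) (x y : E3) : Matrix (Fin 3) (Fin 3) ℝ :=
  deriv (kappa ψ) ⟪x, y⟫ •
      Matrix.vecMulVec (y - ⟪x, y⟫ • x).ofLp (x - ⟪x, y⟫ • y).ofLp +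
    kappa ψ ⟪x, y⟫ • ((1 - Matrix.vecMulVec x.ofLp x.ofLp) * (1 - Matrix.vecMulVec y.ofLp y.ofLp))

/-- The convolution `(C_Ψ f)(x) = ∫ (Ψ^div(x,y) + Ψ^curl(x,y)) f(y) dμ(y)`. -/
def kernelConv (ψ : ℝ → ℝ) (f : L2Field) (x : S2) : E3 :=
  ∫ y : S2, WithLp.toLp 2 ((divKernel ψ x y + curlKernel ψ x y).mulVec (f y).ofLp) ∂surfaceMeasure

end

/-! The convolution is a Fourier multiplier: for `ℓ ≥ 1` it multiplies both coefficients `⟨f,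
𝐲_{ℓ,k}⟩` and `⟨f, 𝐳_{ℓ,k}⟩` by `ψ̂_ρ(ℓ)`. The error estimate then reduces to a bound on `1 -
ψ̂_ρ(ℓ)`. Completeness of the vector harmonics is not needed, because the Sobolev norms are defined
by these coefficients.

Multiplier property. Let `ψ` be a polynomial of the right mass. Then `κ = G'` on `(-1, 1)` for a
polynomial `G` with `((1 - t²) G')' = 1/(4π) - ψ`. For fixed `y` and `e`, the kernel applied to `e`
is the surface curl of `κ(x·y) x·(e×y)` plus the surface gradient of `κ(x·y) x·(e - (y·e)y)`
(`surfaceCurl_add_surfaceGradient_eq`). Against `𝐋⁎Y` or `∇⁎Y`, one summand vanishes because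
gradients and curls are orthogonal. Green's formula turns the other into `ℓ(ℓ+1)` times a moment of
`Y`, which a differentiated Funk–Hecke formula evaluates with the factor `2π ∫ G P_ℓ`. The Legendre
equation gives `ℓ(ℓ+1) · 2π ∫ G P_ℓ = ψ̂(ℓ)`. Everything on the sphere comes from one fact: rotation
invariance makes the integral of `x_j ∂_k h - x_k ∂_j h` vanish.

For continuous `ψ`, the matrix kernel is stable under uniform perturbations of `ψ` that keep its
mass (`norm_zonalKernel_sub_le`): the zeros of the vectors at the poles compensate the singularity
of `κ'`. Polynomial approximation and Fubini finish this part.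

Multiplier bound. With `s = σ - τ ∈ [0, m]`, `exists_multiplier_bound` gives `|1 - ψ̂_ρ(ℓ)| ≤ C (ρ
√(1 + ℓ(ℓ+1)))^s` for every `ρ ∈ (0, 1)` and `ℓ ≥ 1`, and the Sobolev series are compared term by
term. -/

/-! ### Rotation invariance of the surface measure -/

/-- The map of the sphere induced by a linear isometry of `ℝ³`. -/
noncomputable def sphereMap (L : E3 ≃ₗᵢ[ℝ] E3) (x : S2) : S2 := ⟨L x, by simp⟩

lemma continuous_sphereMap (L : E3 ≃ₗᵢ[ℝ] E3) : Continuous (sphereMap L) := by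
  unfold sphereMap; fun_prop

-- `toSphere` measures a set through the Lebesgue volume of the cone over it. The cone over a
-- preimage is the preimage of the cone, and `L` preserves volume.
open scoped Pointwise in
lemma map_sphereMap (L : E3 ≃ₗᵢ[ℝ] E3) :
    surfaceMeasure.map (sphereMap L) = surfaceMeasure := by
  ext s hs
  have hm := (continuous_sphereMap L).measurable
  rw [Measure.map_apply hm hs, Measure.toSphere_apply' _ (hm hs), Measure.toSphere_apply' _ hs]
  have h : Ioo (0 : ℝ) 1 • ((↑) '' (sphereMap L ⁻¹' s) : Set E3) =
      L ⁻¹' (Ioo (0 : ℝ) 1 • ((↑) '' s)) := by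
    ext v
    simp only [mem_preimage, Set.mem_smul, mem_image, Subtype.exists]
    constructor
    · rintro ⟨r, hr, _, ⟨x, hx, hxs, rfl⟩, rfl⟩
      exact ⟨r, hr, L x, ⟨L x, by simpa using hx, hxs, rfl⟩, by simp⟩
    · rintro ⟨r, hr, _, ⟨x, hx, hxs, rfl⟩, h⟩
      refine ⟨r, hr, L.symm x, ⟨L.symm x, by simpa using hx, ?_, rfl⟩, ?_⟩
      · simpa [sphereMap] using hxs
      · rw [← map_smul, h]; simp
  rw [h, L.measurePreserving.measure_preimage_emb L.toHomeomorph.measurableEmbedding]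

lemma integral_comp_sphereMap (L : E3 ≃ₗᵢ[ℝ] E3) {h : E3 → ℝ} (hh : Continuous h) :
    ∫ x : S2, h (L x) ∂surfaceMeasure = ∫ x : S2, h x ∂surfaceMeasure := by
  have := integral_map (μ := surfaceMeasure) (f := fun x : S2 => h x)
    (continuous_sphereMap L).aemeasurable (by fun_prop)
  rw [map_sphereMap] at this
  exact this.symm

/-- The rotation by the angle `θ` in the plane of the coordinates `j ≠ k`. -/
noncomputable def planeRotation (j k : Fin 3) (θ : ℝ) (x : E3) : E3 :=
  x + ((Real.cos θ - 1) * x j - Real.sin θ * x k) • EuclideanSpace.single j (1 : ℝ) +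
    (Real.sin θ * x j + (Real.cos θ - 1) * x k) • EuclideanSpace.single k (1 : ℝ)

lemma norm_planeRotation {j k : Fin 3} (hjk : j ≠ k) (θ : ℝ) (x : E3) :
    ‖planeRotation j k θ x‖ = ‖x‖ := by
  have h : ‖planeRotation j k θ x‖ ^ 2 = ‖x‖ ^ 2 := by
    have := Real.sin_sq_add_cos_sq θ
    rw [EuclideanSpace.real_norm_sq_eq, EuclideanSpace.real_norm_sq_eq]
    fin_cases j <;> fin_cases k <;> simp [Fin.sum_univ_three, planeRotation] at hjk ⊢ <;> grind
  exact (pow_left_inj₀ (norm_nonneg _) (norm_nonneg _) two_ne_zero).1 h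

/-- `planeRotation` as a linear isometry. -/
noncomputable def planeRotationEquiv {j k : Fin 3} (hjk : j ≠ k) (θ : ℝ) : E3 ≃ₗᵢ[ℝ] E3 :=
  LinearIsometry.toLinearIsometryEquiv
    { toFun := planeRotation j k θ
      map_add' := fun x y => by
        ext i; simp only [planeRotation, PiLp.add_apply, PiLp.smul_apply, smul_eq_mul]; ring
      map_smul' := fun r x => by
        ext i
        simp only [planeRotation, PiLp.add_apply, PiLp.smul_apply, smul_eq_mul, RingHom.id_apply]
        ring
      norm_map' := fun x => norm_planeRotation hjk θ x } rfl

lemma planeRotation_zero (j k : Fin 3) (x : E3) : planeRotation j k 0 x = x := by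
  simp [planeRotation]

/-- The partial derivative of a function on `ℝ³`. -/
noncomputable def partialD (i : Fin 3) (h : E3 → ℝ) (x : E3) : ℝ :=
  fderiv ℝ h x (EuclideanSpace.single i 1)

lemma continuous_partialD {h : E3 → ℝ} (hh : ContDiff ℝ 1 h) (i : Fin 3) :
    Continuous (partialD i h) := by
  have := hh.continuous_fderiv one_ne_zero
  unfold partialD
  fun_prop

lemma integrable_of_continuous {h : S2 → ℝ} (hh : Continuous h) : Integrable h surfaceMeasure := by
  obtain ⟨C, hC⟩ := isCompact_univ.exists_bound_of_continuousOn hh.continuousOn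
  exact Integrable.of_bound hh.aestronglyMeasurable C (Filter.Eventually.of_forall fun x => hC x trivial)

/-- The surface measure annihilates the derivatives along rotations. -/
theorem integral_rotation_derivative {h : E3 → ℝ} (hh : ContDiff ℝ 1 h) (j k : Fin 3) :
    ∫ x : S2, ((x : E3) j * partialD k h x - (x : E3) k * partialD j h x) ∂surfaceMeasure = 0 := by
  obtain rfl | hjk := eq_or_ne j k
  · simp
  -- The `θ`-derivative of `planeRotation j k θ x`.
  set R' : ℝ → E3 → E3 := fun θ x =>
    (-Real.sin θ * x j - Real.cos θ * x k) • EuclideanSpace.single j (1 : ℝ) +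
      (Real.cos θ * x j - Real.sin θ * x k) • EuclideanSpace.single k (1 : ℝ) with hR'
  have hR : ∀ (x : E3) θ, HasDerivAt (fun θ => planeRotation j k θ x) (R' θ x) θ := by
    intro x θ
    have h1 := (((((Real.hasDerivAt_cos θ).sub_const 1).mul_const (x j)).sub
      ((Real.hasDerivAt_sin θ).mul_const (x k))).smul_const
        (EuclideanSpace.single j (1 : ℝ))).const_add x
    have h2 := ((((Real.hasDerivAt_sin θ).mul_const (x j)).add
      (((Real.hasDerivAt_cos θ).sub_const 1).mul_const (x k))).smul_const
        (EuclideanSpace.single k (1 : ℝ)))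
    refine (h1.add h2).congr_deriv ?_
    simp only [hR']
    congr 2
    ring
  have hcR : ∀ θ, Continuous (planeRotation j k θ) := fun θ => by
    unfold planeRotation; fun_prop
  obtain ⟨M, hM⟩ := (isCompact_sphere (0 : E3) 1).exists_bound_of_continuousOn
    (hh.continuous_fderiv one_ne_zero).continuousOn
  have hM0 : 0 ≤ M := (norm_nonneg _).trans (hM (EuclideanSpace.single 0 1) (by simp))
  have hcoord : ∀ (x : S2) (i : Fin 3), |(x : E3) i| ≤ 1 := fun x i => by
    have := PiLp.norm_apply_le (x : E3) i
    simpa using this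
  have hbd : ∀ (x : S2) θ, ‖R' θ x‖ ≤ 4 := by
    intro x θ
    have hs := Real.abs_sin_le_one θ
    have hc := Real.abs_cos_le_one θ
    have e1 : ∀ u v : ℝ, |u| ≤ 1 → |v| ≤ 1 → |u * v| ≤ 1 := fun u v hu hv => by
      rw [abs_mul]; exact mul_le_one₀ hu (abs_nonneg _) hv
    refine (norm_add_le _ _).trans ?_
    simp only [norm_smul, PiLp.norm_single, norm_one, mul_one, Real.norm_eq_abs]
    have a1 := abs_le.1 (e1 _ _ hs (hcoord x j))
    have a2 := abs_le.1 (e1 _ _ hc (hcoord x k))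
    have a3 := abs_le.1 (e1 _ _ hc (hcoord x j))
    have a4 := abs_le.1 (e1 _ _ hs (hcoord x k))
    have b1 : |-Real.sin θ * (x : E3) j - Real.cos θ * (x : E3) k| ≤ 2 :=
      abs_le.2 ⟨by linarith, by linarith⟩
    have b2 : |Real.cos θ * (x : E3) j - Real.sin θ * (x : E3) k| ≤ 2 :=
      abs_le.2 ⟨by linarith, by linarith⟩
    linarith
  have key := hasDerivAt_integral_of_dominated_loc_of_deriv_le (μ := surfaceMeasure)
    (F := fun θ (x : S2) => h (planeRotation j k θ x))
    (F' := fun θ (x : S2) => fderiv ℝ h (planeRotation j k θ x) (R' θ x))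
    (x₀ := (0 : ℝ)) (bound := fun _ => M * 4) (s := univ) Filter.univ_mem
    (Filter.Eventually.of_forall fun θ =>
      (hh.continuous.comp ((hcR θ).comp continuous_subtype_val)).aestronglyMeasurable)
    (integrable_of_continuous (hh.continuous.comp ((hcR 0).comp continuous_subtype_val)))
    (by
      have h1 := hh.continuous_fderiv one_ne_zero
      have h2 := (hcR 0)
      refine Continuous.aestronglyMeasurable ?_
      simp only [hR']
      fun_prop)
    (Filter.Eventually.of_forall fun x θ _ => by
      refine (ContinuousLinearMap.le_opNorm _ _).trans ?_
      exact mul_le_mul (hM _ (by simp [norm_planeRotation hjk])) (hbd x θ) (norm_nonneg _) hM0)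
    (integrable_const _)
    (Filter.Eventually.of_forall fun x θ _ =>
      ((hh.differentiable one_ne_zero) _).hasFDerivAt.comp_hasDerivAt θ (hR x θ))
  -- Rotation invariance makes this integral constant in `θ`, so the derivative in `key` is zero. At
  -- `θ = 0` it is the integral in the claim.
  have hconst : (fun θ => ∫ x : S2, h (planeRotation j k θ x) ∂surfaceMeasure) =
      fun _ => ∫ x : S2, h x ∂surfaceMeasure :=
    funext fun θ => integral_comp_sphereMap (planeRotationEquiv hjk θ) hh.continuous
  have h0 := key.2
  rw [hconst] at h0
  rw [← h0.unique (hasDerivAt_const _ _)]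
  refine integral_congr_ae (Filter.Eventually.of_forall fun x => ?_)
  simp [planeRotation_zero, hR', partialD]
  ring

/-! ### Polynomial functions -/

lemma contDiff_polyFun (p : MvPolynomial (Fin 3) ℝ) {n : WithTop ℕ∞} : ContDiff ℝ n (polyFun p) := by
  unfold polyFun
  induction p using MvPolynomial.induction_on with
  | C a => simpa using contDiff_const
  | add p q hp hq => simpa using hp.add hq
  | mul_X p i hp =>
    simp only [map_mul, MvPolynomial.eval_X]
    exact hp.mul (by fun_prop)

lemma continuous_polyFun (p : MvPolynomial (Fin 3) ℝ) : Continuous (polyFun p) :=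
  (contDiff_polyFun p (n := 0)).continuous

lemma differentiable_polyFun (p : MvPolynomial (Fin 3) ℝ) : Differentiable ℝ (polyFun p) :=
  (contDiff_polyFun p (n := 1)).differentiable one_ne_zero

lemma partialD_mul {f g : E3 → ℝ} (hf : Differentiable ℝ f) (hg : Differentiable ℝ g) (i : Fin 3)
    (x : E3) : partialD i (fun x => f x * g x) x = partialD i f x * g x + f x * partialD i g x := by
  unfold partialD
  rw [fderiv_fun_mul (hf x) (hg x)]
  simp
  ring

lemma partialD_polyFun (p : MvPolynomial (Fin 3) ℝ) (i : Fin 3) (x : E3) :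
    partialD i (polyFun p) x = polyFun (MvPolynomial.pderiv i p) x := by
  induction p using MvPolynomial.induction_on with
  | C a =>
    have : polyFun (MvPolynomial.C a) = fun _ => a := by ext; simp [polyFun]
    simp [this, partialD]
    simp [polyFun]
  | add p q hp hq =>
    have : polyFun (p + q) = fun x => polyFun p x + polyFun q x := by ext; simp [polyFun]
    rw [this, map_add]
    unfold partialD at *
    rw [fderiv_fun_add (differentiable_polyFun p x) (differentiable_polyFun q x)]
    simp [hp, hq]
    simp [polyFun]
  | mul_X p j hp =>
    have : polyFun (p * MvPolynomial.X j) = fun x => polyFun p x * x j := by ext; simp [polyFun]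
    rw [this, partialD_mul (differentiable_polyFun p) (by fun_prop), hp, MvPolynomial.pderiv_mul]
    have : partialD i (fun x => x j) x = if j = i then 1 else 0 := by
      unfold partialD
      have : (fun x : E3 => x j) = EuclideanSpace.proj (𝕜 := ℝ) j := rfl
      rw [this, ContinuousLinearMap.fderiv]
      simp
    rw [this, MvPolynomial.pderiv_X]
    by_cases h : j = i
    · subst h; simp [polyFun]
    · simp [polyFun, h]

/-- The derivation `X_j ∂_k - X_k ∂_j`, the infinitesimal rotation in the plane of the coordinates
`j` and `k`. -/
noncomputable def rotD (j k : Fin 3) :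
    Derivation ℝ (MvPolynomial (Fin 3) ℝ) (MvPolynomial (Fin 3) ℝ) :=
  (MvPolynomial.X j : MvPolynomial (Fin 3) ℝ) • MvPolynomial.pderiv k -
    (MvPolynomial.X k : MvPolynomial (Fin 3) ℝ) • MvPolynomial.pderiv j

lemma rotD_apply (j k : Fin 3) (p : MvPolynomial (Fin 3) ℝ) :
    rotD j k p = MvPolynomial.X j * MvPolynomial.pderiv k p -
      MvPolynomial.X k * MvPolynomial.pderiv j p := rfl

/-- Integration by parts for infinitesimal rotations. -/
theorem integral_rotation_mul_polyFun {g : E3 → ℝ} (hg : ContDiff ℝ 1 g)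
    (p : MvPolynomial (Fin 3) ℝ) (j k : Fin 3) :
    ∫ x : S2, ((x : E3) j * partialD k g x - (x : E3) k * partialD j g x) * polyFun p x
      ∂surfaceMeasure = -∫ x : S2, g x * polyFun (rotD j k p) x ∂surfaceMeasure := by
  have h := integral_rotation_derivative (hg.mul (contDiff_polyFun p)) j k
  have hd := hg.differentiable one_ne_zero
  have c1 := continuous_partialD hg k
  have c2 := continuous_partialD hg j
  have c3 := continuous_polyFun p
  have c4 := continuous_polyFun (rotD j k p)
  have c5 := hg.continuous
  rw [eq_neg_iff_add_eq_zero, ← integral_add, ← h]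
  · refine integral_congr_ae (Filter.Eventually.of_forall fun x => ?_)
    have e := fun i => partialD_mul hd (differentiable_polyFun p) i x
    beta_reduce
    rw [e, e, partialD_polyFun, partialD_polyFun, rotD_apply]
    simp [polyFun]
    ring
  · exact integrable_of_continuous (by fun_prop)
  · exact integrable_of_continuous (by fun_prop)

/-! ### Legendre polynomials -/

section Legendre

open Polynomial

lemma iterate_derivative_succ_X_mul (n : ℕ) (f : ℝ[X]) :
    derivative^[n + 1] (X * f) = X * derivative^[n + 1] f + (n + 1 : ℝ[X]) * derivative^[n] f := by
  induction n with
  | zero => simp; ring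
  | succ n ih =>
    rw [Function.iterate_succ_apply', ih]
    simp only [derivative_add, derivative_mul, derivative_X, derivative_one, derivative_natCast,
      ← Function.iterate_succ_apply' derivative]
    push_cast
    ring

lemma iterate_derivative_const_mul (n : ℕ) (a : ℝ) (f : ℝ[X]) :
    derivative^[n] (C a * f) = C a * derivative^[n] f := by
  simp

lemma derivative_X_sq_sub_one_pow_succ (ℓ : ℕ) :
    derivative ((X ^ 2 - 1 : ℝ[X]) ^ (ℓ + 1)) = C (2 * (ℓ + 1 : ℝ)) * (X * (X ^ 2 - 1) ^ ℓ) := by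
  rw [derivative_pow]
  simp [C_mul, show (C 2 : ℝ[X]) = 2 from rfl]
  ring

/-- One derivative in Rodrigues' formula falls on `(X² - 1)^(ℓ+1)` and produces the factor `X (X² -
1)^ℓ`. Leibniz' rule for the factor `X` gives the two terms. -/
lemma derivative_legendreP_succ (ℓ : ℕ) :
    derivative (legendreP (ℓ + 1)) =
      X * derivative (legendreP ℓ) + (ℓ + 1 : ℝ[X]) * legendreP ℓ := by
  unfold legendreP
  simp only [derivative_C_mul, ← Function.iterate_succ_apply' derivative]
  rw [Function.iterate_succ_apply, derivative_X_sq_sub_one_pow_succ, iterate_derivative_const_mul,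
    iterate_derivative_succ_X_mul, ← mul_assoc, ← C_mul]
  have : (2 ^ (ℓ + 1) * ((ℓ + 1).factorial : ℝ))⁻¹ * (2 * (ℓ + 1)) =
      (2 ^ ℓ * (ℓ.factorial : ℝ))⁻¹ := by
    rw [Nat.factorial_succ]; push_cast; rw [pow_succ]; field_simp
  rw [this]
  ring

lemma legendreP_zero : legendreP 0 = 1 := by simp [legendreP]

/-- The Legendre differential equation. -/
lemma legendreP_ode (ℓ : ℕ) :
    derivative ((1 - X ^ 2) * derivative (legendreP ℓ)) =
      -((ℓ : ℝ[X]) * ((ℓ : ℝ[X]) + 1)) * legendreP ℓ := by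
  set u : ℝ[X] := (X ^ 2 - 1) ^ ℓ with hu
  -- The first-order equation `(X² - 1) u' = 2ℓ X u`. Its `(ℓ+1)`-st derivative is the Legendre
  -- equation for the `ℓ`-th derivative of `u`.
  have h0 : X * (X * derivative u) - derivative u = C (2 * (ℓ : ℝ)) * (X * u) := by
    cases ℓ with
    | zero => simp [hu]
    | succ n =>
      rw [hu, derivative_X_sq_sub_one_pow_succ]
      push_cast
      ring
  have h1 := congrArg (derivative^[ℓ + 1]) h0
  rw [iterate_derivative_sub, iterate_derivative_succ_X_mul, iterate_derivative_const_mul,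
    iterate_derivative_succ_X_mul, iterate_derivative_succ_X_mul] at h1
  have h2 : derivative^[ℓ] (X * derivative u) =
      X * derivative^[ℓ + 1] u + (ℓ : ℝ[X]) * derivative^[ℓ] u := by
    cases ℓ with
    | zero => simp
    | succ n =>
      rw [iterate_derivative_succ_X_mul]
      simp only [← Function.iterate_succ_apply derivative]
      push_cast
      ring
  rw [h2] at h1
  simp only [← Function.iterate_succ_apply derivative] at h1
  unfold legendreP
  rw [← hu]
  simp only [Function.iterate_succ_apply'] at h1
  simp only [derivative_mul, derivative_C, derivative_sub, derivative_one, derivative_X_pow, zero_mul,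
    zero_add, C_mul, map_natCast, map_ofNat] at h1 ⊢
  push_cast
  linear_combination -(C (2 ^ ℓ * (ℓ.factorial : ℝ))⁻¹) * h1

/-- The second-order term of the Legendre equation drops out at `1`. Together with
`derivative_legendreP_succ` this fixes `P_ℓ(1)` by induction. -/
lemma two_mul_eval_one_derivative_legendreP (ℓ : ℕ) :
    2 * (derivative (legendreP ℓ)).eval 1 = (ℓ : ℝ) * (ℓ + 1) * (legendreP ℓ).eval 1 := by
  have := congrArg (eval 1) (legendreP_ode ℓ)
  simp [derivative_mul] at this
  linear_combination this

lemma eval_one_legendreP (ℓ : ℕ) : (legendreP ℓ).eval 1 = 1 := by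
  induction ℓ with
  | zero => simp [legendreP_zero]
  | succ n ih =>
    have h1 := two_mul_eval_one_derivative_legendreP (n + 1)
    have h2 := two_mul_eval_one_derivative_legendreP n
    have h3 := congrArg (eval 1) (derivative_legendreP_succ n)
    simp [ih] at h1 h2 h3
    have : ((n : ℝ) + 1) * (n + 2) * ((legendreP (n + 1)).eval 1 - 1) = 0 := by linarith
    have hn : ((n : ℝ) + 1) * (n + 2) ≠ 0 := by positivity
    have := (mul_eq_zero.1 this).resolve_left hn
    linarith

/-- Both sides have the same derivative by the Legendre equation and agree at `1`. -/
lemma succ_mul_legendreP_succ (ℓ : ℕ) :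
    (ℓ + 1 : ℝ[X]) * legendreP (ℓ + 1) =
      (X ^ 2 - 1) * derivative (legendreP ℓ) + (ℓ + 1 : ℝ[X]) * (X * legendreP ℓ) := by
  have hd : derivative ((ℓ + 1 : ℝ[X]) * legendreP (ℓ + 1) -
      ((X ^ 2 - 1) * derivative (legendreP ℓ) + (ℓ + 1 : ℝ[X]) * (X * legendreP ℓ))) = 0 := by
    have h1 := derivative_legendreP_succ ℓ
    have h2 := legendreP_ode ℓ
    simp only [derivative_mul, derivative_sub, derivative_add, derivative_one, derivative_X_pow,
      derivative_natCast, derivative_X] at h2 ⊢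
    push_cast at h2 ⊢
    linear_combination (ℓ + 1 : ℝ[X]) * h1 + h2
  have h := eq_C_of_natDegree_eq_zero (derivative_eq_zero.1 hd)
  have he := congrArg (eval 1) h
  simp only [eval_sub, eval_mul, eval_add, eval_natCast, eval_one, eval_pow, eval_X,
    eval_one_legendreP, eval_C] at he
  rw [← sub_eq_zero, h, ← he, C_eq_zero]
  ring

lemma one_sub_sq_mul_derivative_legendreP_succ (ℓ : ℕ) :
    (1 - X ^ 2) * derivative (legendreP (ℓ + 1)) =
      (ℓ + 1 : ℝ[X]) * (legendreP ℓ - X * legendreP (ℓ + 1)) := by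
  have h1 := derivative_legendreP_succ ℓ
  have h2 := succ_mul_legendreP_succ ℓ
  linear_combination (1 - X ^ 2) * h1 + X * h2

/-- Integration of polynomials over `[-1, 1]`. -/
noncomputable def polyInt : ℝ[X] →ₗ[ℝ] ℝ where
  toFun q := ∫ t in (-1 : ℝ)..1, q.eval t
  map_add' p q := by
    simp only [eval_add]
    exact intervalIntegral.integral_add (p.continuous.intervalIntegrable _ _)
      (q.continuous.intervalIntegrable _ _)
  map_smul' a q := by simp

lemma polyInt_derivative (q : ℝ[X]) : polyInt (derivative q) = q.eval 1 - q.eval (-1) :=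
  intervalIntegral.integral_eq_sub_of_hasDerivAt (fun t _ => q.hasDerivAt t)
    ((derivative q).continuous.intervalIntegrable _ _)

lemma polyInt_natCast_mul (n : ℕ) (q : ℝ[X]) : polyInt ((n : ℝ[X]) * q) = n * polyInt q := by
  rw [← nsmul_eq_mul, map_nsmul, nsmul_eq_mul]

/-- `X^n (1 - X²) P_ℓ` vanishes at `±1`, so its derivative has integral zero. The recursion mirrors
`sphereInt_linPoly_pow_succ_mul`. The truncated `n - 1` and `ℓ - 1` are harmless, since they come
with the factors `n` and `ℓ`. -/
lemma polyInt_X_pow_mul_legendreP (n ℓ : ℕ) :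
    ((n : ℝ) + ℓ + 2) * polyInt (X ^ (n + 1) * legendreP ℓ) =
      n * polyInt (X ^ (n - 1) * legendreP ℓ) + ℓ * polyInt (X ^ n * legendreP (ℓ - 1)) := by
  have hP : (1 - X ^ 2) * derivative (legendreP ℓ) =
      (ℓ : ℝ[X]) * (legendreP (ℓ - 1) - X * legendreP ℓ) := by
    cases ℓ with
    | zero => simp [legendreP_zero]
    | succ k => simpa using one_sub_sq_mul_derivative_legendreP_succ k
  have hd : derivative (X ^ n * ((1 - X ^ 2) * legendreP ℓ)) =
      (n : ℝ[X]) * (X ^ (n - 1) * legendreP ℓ) + (ℓ : ℝ[X]) * (X ^ n * legendreP (ℓ - 1)) -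
        ((n + ℓ + 2 : ℕ) : ℝ[X]) * (X ^ (n + 1) * legendreP ℓ) := by
    have hn : (n : ℝ[X]) * (X ^ (n - 1) * X ^ 2) = (n : ℝ[X]) * X ^ (n + 1) := by
      cases n with
      | zero => simp
      | succ k => rw [Nat.add_sub_cancel, ← pow_add]
    simp only [derivative_mul, derivative_sub, derivative_one, derivative_X_pow, map_natCast]
    push_cast
    linear_combination X ^ n * hP - legendreP ℓ * hn
  have h := polyInt_derivative (X ^ n * ((1 - X ^ 2) * legendreP ℓ))
  rw [hd] at h
  simp only [map_sub, map_add, polyInt_natCast_mul] at h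
  simp only [eval_mul, eval_sub, eval_one, eval_pow, eval_X] at h
  push_cast at h
  linarith

lemma polyInt_legendreP (ℓ : ℕ) : polyInt (legendreP ℓ) = if ℓ = 0 then 2 else 0 := by
  split_ifs with h
  · subst h
    rw [legendreP_zero]
    simp [polyInt]
    norm_num
  · have h1 := polyInt_derivative ((1 - X ^ 2) * derivative (legendreP ℓ))
    rw [legendreP_ode] at h1
    have : -((ℓ : ℝ[X]) * ((ℓ : ℝ[X]) + 1)) * legendreP ℓ = -(((ℓ * (ℓ + 1) : ℕ) : ℝ[X]) * legendreP ℓ) := by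
      push_cast; ring
    rw [this, map_neg, polyInt_natCast_mul] at h1
    simp at h1
    rcases h1 with (h1 | h1) | h1
    · exact absurd h1 h
    · exact absurd h1 (by positivity)
    · exact h1

/-- Multiplying the Legendre coefficient of a primitive `G` of `q` by `ℓ (ℓ + 1)`. -/
lemma polyInt_primitive_mul_legendreP (G : ℝ[X]) (ℓ : ℕ) :
    (ℓ : ℝ) * (ℓ + 1) * polyInt (G * legendreP ℓ) =
      -polyInt (derivative ((1 - X ^ 2) * derivative G) * legendreP ℓ) := by
  -- Self-adjointness of the Legendre operator: the derivative of `(1 - X²)(G' P_ℓ - G P_ℓ')` has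
  -- integral zero.
  have h := polyInt_derivative ((1 - X ^ 2) * (derivative G * legendreP ℓ) -
    (1 - X ^ 2) * derivative (legendreP ℓ) * G)
  have hd : derivative ((1 - X ^ 2) * (derivative G * legendreP ℓ) -
      (1 - X ^ 2) * derivative (legendreP ℓ) * G) =
      ((ℓ * (ℓ + 1) : ℕ) : ℝ[X]) * (G * legendreP ℓ) +
        derivative ((1 - X ^ 2) * derivative G) * legendreP ℓ := by
    have := legendreP_ode ℓ
    rw [derivative_sub, derivative_mul (f := (1 - X ^ 2) * derivative (legendreP ℓ)), this]
    simp only [derivative_mul, Nat.cast_mul, Nat.cast_add]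
    push_cast
    ring
  rw [hd, map_add, polyInt_natCast_mul] at h
  simp only [eval_sub, eval_mul, eval_one, eval_pow, eval_X] at h
  push_cast at h
  linarith

end Legendre

/-! ### Integrals of polynomials over the sphere -/

section Harmonic

open MvPolynomial

lemma pderiv_comm {σ : Type*} (i j : σ) (p : MvPolynomial σ ℝ) :
    pderiv i (pderiv j p) = pderiv j (pderiv i p) := by
  classical
  have h : ⁅pderiv (R := ℝ) i, pderiv (R := ℝ) j⁆ = 0 := by
    refine MvPolynomial.derivation_ext fun k => ?_
    rw [Derivation.commutator_apply, pderiv_X, pderiv_X]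
    by_cases h1 : j = k <;> by_cases h2 : i = k <;> simp [h1, h2]
  have := congrArg (fun D => D p) h
  rw [Derivation.commutator_apply] at this
  exact sub_eq_zero.1 this

/-- Integration of polynomials over the sphere. -/
noncomputable def sphereInt : MvPolynomial (Fin 3) ℝ →ₗ[ℝ] ℝ where
  toFun p := ∫ x : S2, polyFun p x ∂surfaceMeasure
  map_add' p q := by
    have hp := (continuous_polyFun p).comp (continuous_subtype_val (p := (· ∈ Metric.sphere (0 : E3) 1)))
    have hq := (continuous_polyFun q).comp (continuous_subtype_val (p := (· ∈ Metric.sphere (0 : E3) 1)))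
    refine Eq.trans ?_
      (integral_add (integrable_of_continuous hp) (integrable_of_continuous hq))
    simp [polyFun]
  map_smul' a p := by
    simp [polyFun, smul_eval, integral_const_mul]

lemma sphereInt_apply (p : MvPolynomial (Fin 3) ℝ) :
    sphereInt p = ∫ x : S2, polyFun p x ∂surfaceMeasure := rfl

lemma sphereInt_C_mul (a : ℝ) (p : MvPolynomial (Fin 3) ℝ) :
    sphereInt (C a * p) = a * sphereInt p := by
  rw [C_mul', map_smul, smul_eq_mul]

lemma sphereInt_natCast_mul (n : ℕ) (p : MvPolynomial (Fin 3) ℝ) :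
    sphereInt ((n : MvPolynomial (Fin 3) ℝ) * p) = n * sphereInt p := by
  rw [← nsmul_eq_mul, map_nsmul, nsmul_eq_mul]

lemma sphereInt_rotD (j k : Fin 3) (p : MvPolynomial (Fin 3) ℝ) : sphereInt (rotD j k p) = 0 := by
  rw [sphereInt_apply, ← integral_rotation_derivative (contDiff_polyFun p) j k]
  refine integral_congr_ae (Filter.Eventually.of_forall fun x => ?_)
  simp only [partialD_polyFun, rotD_apply]
  simp [polyFun]

lemma surfaceMeasure_real_univ : surfaceMeasure.real univ = 4 * Real.pi := by
  rw [Measure.toSphere_real_apply_univ, measureReal_def, EuclideanSpace.volume_ball_fin_three]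
  simp [ENNReal.toReal_ofReal (show 0 ≤ Real.pi * 4 / 3 by positivity)]
  ring

lemma sphereInt_C (a : ℝ) : sphereInt (C a) = 4 * Real.pi * a := by
  rw [sphereInt_apply]
  simp [polyFun, -Measure.toSphere_real_apply_univ, surfaceMeasure_real_univ]

/-- The squared norm as a polynomial. -/
noncomputable def normSqPoly : MvPolynomial (Fin 3) ℝ := ∑ i, X i ^ 2

lemma sum_sq_coord (x : S2) : (x : E3) 0 ^ 2 + (x : E3) 1 ^ 2 + (x : E3) 2 ^ 2 = 1 := by
  have := EuclideanSpace.real_norm_sq_eq (x : E3)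
  rw [Fin.sum_univ_three] at this
  rw [← this]
  simp

lemma sphereInt_normSqPoly_mul (p : MvPolynomial (Fin 3) ℝ) :
    sphereInt (normSqPoly * p) = sphereInt p := by
  refine integral_congr_ae (Filter.Eventually.of_forall fun x => ?_)
  simp [polyFun, normSqPoly, Fin.sum_univ_three, sum_sq_coord]

/-- The integral of a partial derivative of a homogeneous polynomial over the sphere. -/
lemma sphereInt_pderiv {F : MvPolynomial (Fin 3) ℝ} {n : ℕ} (hF : F.IsHomogeneous n) (i : Fin 3) :
    sphereInt (pderiv i F) = (n + 2) * sphereInt (X i * F) := by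
  have he := hF.sum_X_mul_pderiv
  rw [Fin.sum_univ_three, nsmul_eq_mul] at he
  -- Modulo rotational derivatives, which integrate to zero, `∂_i F` is a multiple of `X_i F` on the
  -- sphere. Euler's identity contributes `n`, and the derivatives of the factors `X_j` contribute
  -- `3 - 1 = 2`.
  have h : normSqPoly * pderiv i F = ((n + 2 : ℕ) : MvPolynomial (Fin 3) ℝ) * (X i * F) +
      (rotD 0 i (X 0 * F) + rotD 1 i (X 1 * F) + rotD 2 i (X 2 * F)) := by
    push_cast
    rw [add_mul, mul_left_comm, ← he]
    fin_cases i <;>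
    · simp only [rotD_apply, normSqPoly, Fin.sum_univ_three, pderiv_mul, pderiv_X]
      simp
      ring
  rw [← sphereInt_normSqPoly_mul, h]
  simp only [map_add, sphereInt_rotD, sphereInt_natCast_mul]
  push_cast
  ring

/-- The spherical Laplacian as a sum of squares of infinitesimal rotations. -/
lemma sum_rotD_rotD {p : MvPolynomial (Fin 3) ℝ} {ℓ : ℕ} (hp : p ∈ harmonicSpace ℓ) :
    rotD 1 2 (rotD 1 2 p) + rotD 2 0 (rotD 2 0 p) + rotD 0 1 (rotD 0 1 p) =
      -((ℓ * (ℓ + 1) : ℕ) : MvPolynomial (Fin 3) ℝ) * p := by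
  obtain ⟨h1, h2⟩ := Submodule.mem_inf.1 hp
  have he := (((mem_homogeneousSubmodule _ _).1 h1)).sum_X_mul_pderiv
  rw [LinearMap.mem_ker] at h2
  simp only [polyLaplacian, Fin.sum_univ_three, LinearMap.add_apply, LinearMap.comp_apply,
    Derivation.coeFn_coe, nsmul_eq_mul] at h2 he
  have e0 := congrArg (pderiv 0) he
  have e1 := congrArg (pderiv 1) he
  have e2 := congrArg (pderiv 2) he
  have c1 := pderiv_comm 0 1 p
  have c2 := pderiv_comm 0 2 p
  have c3 := pderiv_comm 1 2 p
  simp only [rotD_apply, map_sub, map_add, pderiv_mul, pderiv_X, Pi.single_apply, Derivation.map_natCast] at e0 e1 e2 ⊢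
  simp at e0 e1 e2 ⊢
  rw [c1] at *
  rw [c2] at *
  rw [c3] at *
  linear_combination (X 0 ^ 2 + X 1 ^ 2 + X 2 ^ 2) * h2 - X 0 * e0 - X 1 * e1 - X 2 * e2 - (ℓ + 1 : MvPolynomial (Fin 3) ℝ) * he

/-- Infinitesimal rotations preserve the degree and commute with the Laplacian. Degree zero is
separate because `pderiv` lowers degrees with truncated subtraction. -/
lemma rotD_mem_harmonicSpace {p : MvPolynomial (Fin 3) ℝ} {ℓ : ℕ} (hp : p ∈ harmonicSpace ℓ)
    (j k : Fin 3) : rotD j k p ∈ harmonicSpace ℓ := by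
  obtain ⟨h1, h2⟩ := Submodule.mem_inf.1 hp
  rw [mem_homogeneousSubmodule] at h1
  refine Submodule.mem_inf.2 ⟨?_, ?_⟩
  · rw [mem_homogeneousSubmodule]
    cases ℓ with
    | zero =>
      obtain ⟨a, rfl⟩ : ∃ a, p = C a :=
        ⟨_, totalDegree_eq_zero_iff_eq_C.1 (Nat.le_zero.1 h1.totalDegree_le)⟩
      simp [isHomogeneous_zero]
    | succ n =>
      rw [rotD_apply, add_comm n 1]
      exact ((isHomogeneous_X ℝ j).mul h1.pderiv).sub ((isHomogeneous_X ℝ k).mul h1.pderiv)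
  · rw [LinearMap.mem_ker] at h2 ⊢
    have d := fun i => congrArg (pderiv i) h2
    have d0 := d 0
    have d1 := d 1
    have d2 := d 2
    simp only [polyLaplacian, Fin.sum_univ_three, LinearMap.add_apply, LinearMap.comp_apply,
      Derivation.coeFn_coe, map_add, map_zero] at d0 d1 d2 ⊢
    have c1 := pderiv_comm (σ := Fin 3) 1 0
    have c2 := pderiv_comm (σ := Fin 3) 2 0
    have c3 := pderiv_comm (σ := Fin 3) 2 1
    simp only [c1, c2, c3] at d0 d1 d2
    fin_cases j <;> fin_cases k <;>
    · simp only [rotD_apply, map_sub, map_add, pderiv_mul, pderiv_X, Pi.single_apply]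
      simp [c1, c2, c3]
      try linear_combination X 0 * d1 - X 1 * d0
      try linear_combination X 1 * d2 - X 2 * d1
      try linear_combination X 2 * d0 - X 0 * d2
      try linear_combination -X 0 * d1 + X 1 * d0
      try linear_combination -X 1 * d2 + X 2 * d1
      try linear_combination -X 2 * d0 + X 0 * d2

/-- The directional derivative along `y`. -/
noncomputable def dirD (y : E3) : MvPolynomial (Fin 3) ℝ →ₗ[ℝ] MvPolynomial (Fin 3) ℝ :=
  ∑ i, y i • (pderiv i).toLinearMap

lemma dirD_apply (y : E3) (p : MvPolynomial (Fin 3) ℝ) :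
    dirD y p = ∑ i, C (y i) * pderiv i p := by
  simp [dirD, C_mul']

/-- The linear form `x ↦ ⟪x, y⟫` as a polynomial. -/
noncomputable def linPoly (y : E3) : MvPolynomial (Fin 3) ℝ := ∑ i, C (y i) * X i

lemma polyFun_linPoly (y x : E3) : polyFun (linPoly y) x = ⟪x, y⟫ := by
  simp [polyFun, linPoly, PiLp.inner_apply]

lemma isHomogeneous_linPoly (y : E3) : (linPoly y).IsHomogeneous 1 :=
  IsHomogeneous.sum _ _ _ fun i _ => by
    simpa using (isHomogeneous_C (Fin 3) (y i)).mul (isHomogeneous_X ℝ i)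

lemma dirD_mem_harmonicSpace {p : MvPolynomial (Fin 3) ℝ} {ℓ : ℕ} (hp : p ∈ harmonicSpace ℓ)
    (y : E3) : dirD y p ∈ harmonicSpace (ℓ - 1) := by
  obtain ⟨h1, h2⟩ := Submodule.mem_inf.1 hp
  rw [mem_homogeneousSubmodule] at h1
  simp only [dirD, LinearMap.sum_apply, LinearMap.smul_apply]
  refine Submodule.sum_mem _ fun i _ => Submodule.smul_mem _ _ (Submodule.mem_inf.2 ⟨h1.pderiv, ?_⟩)
  rw [LinearMap.mem_ker] at h2 ⊢
  have d := congrArg (pderiv i) h2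
  simp only [polyLaplacian, LinearMap.sum_apply, LinearMap.comp_apply, Derivation.coeFn_coe,
    map_sum, map_zero] at d ⊢
  rw [← d]
  refine Finset.sum_congr rfl fun j _ => ?_
  rw [pderiv_comm j i p, pderiv_comm j i]

lemma polyFun_dirD_self {p : MvPolynomial (Fin 3) ℝ} {ℓ : ℕ} (hp : p ∈ harmonicSpace ℓ) (y : E3) :
    polyFun (dirD y p) y = ℓ * polyFun p y := by
  have h := congrArg (eval y.ofLp)
    ((mem_homogeneousSubmodule _ _).1 (Submodule.mem_inf.1 hp).1).sum_X_mul_pderiv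
  simpa [polyFun, dirD_apply] using h

lemma exists_eq_C_of_mem_harmonicSpace_zero {p : MvPolynomial (Fin 3) ℝ} (hp : p ∈ harmonicSpace 0) :
    ∃ a, p = C a :=
  ⟨_, totalDegree_eq_zero_iff_eq_C.1
    (Nat.le_zero.1 ((mem_homogeneousSubmodule _ _).1 (Submodule.mem_inf.1 hp).1).totalDegree_le)⟩

/-- By `sum_rotD_rotD`, `ℓ(ℓ+1) p` is a sum of rotational derivatives, each of integral zero. -/
lemma sphereInt_of_mem_harmonicSpace {p : MvPolynomial (Fin 3) ℝ} {ℓ : ℕ}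
    (hp : p ∈ harmonicSpace ℓ) (hℓ : ℓ ≠ 0) : sphereInt p = 0 := by
  have h := congrArg sphereInt (sum_rotD_rotD hp)
  rw [neg_mul, map_neg, sphereInt_natCast_mul] at h
  simp only [map_add, sphereInt_rotD] at h
  have h0 : ((ℓ * (ℓ + 1) : ℕ) : ℝ) ≠ 0 := by positivity
  have : ((ℓ * (ℓ + 1) : ℕ) : ℝ) * sphereInt p = 0 := by linarith
  exact (mul_eq_zero.1 this).resolve_left h0

/-- This is `sphereInt_pderiv` along `y` for `⟪x, y⟫^n p`, homogeneous of degree `n + ℓ`. Since `‖y‖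
= 1`, the form `⟪x, y⟫` has derivative `1` along `y`. -/
lemma sphereInt_linPoly_pow_succ_mul {p : MvPolynomial (Fin 3) ℝ} {ℓ : ℕ}
    (hp : p ∈ harmonicSpace ℓ) {y : E3} (hy : ‖y‖ = 1) (n : ℕ) :
    ((n : ℝ) + ℓ + 2) * sphereInt (linPoly y ^ (n + 1) * p) =
      n * sphereInt (linPoly y ^ (n - 1) * p) + sphereInt (linPoly y ^ n * dirD y p) := by
  have hF : (linPoly y ^ n * p).IsHomogeneous (n + ℓ) := by
    simpa using ((isHomogeneous_linPoly y).pow n).mul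
      ((mem_homogeneousSubmodule _ _).1 (Submodule.mem_inf.1 hp).1)
  have hy' : y 0 ^ 2 + y 1 ^ 2 + y 2 ^ 2 = 1 := sum_sq_coord ⟨y, by simpa using hy⟩
  have hyC : C (y 0) ^ 2 + C (y 1) ^ 2 + C (y 2) ^ 2 = (1 : MvPolynomial (Fin 3) ℝ) := by
    rw [← C_pow, ← C_pow, ← C_pow, ← C_add, ← C_add, hy', C_1]
  have h1 : sphereInt (dirD y (linPoly y ^ n * p)) =
      ((n : ℝ) + ℓ + 2) * sphereInt (linPoly y ^ (n + 1) * p) := by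
    have e : linPoly y ^ (n + 1) * p = ∑ i, C (y i) * (X i * (linPoly y ^ n * p)) := by
      rw [pow_succ']
      nth_rewrite 1 [linPoly]
      rw [mul_assoc, Finset.sum_mul]
      exact Finset.sum_congr rfl fun i _ => by ring
    rw [e, dirD_apply, map_sum, map_sum, Finset.mul_sum]
    refine Finset.sum_congr rfl fun i _ => ?_
    rw [sphereInt_C_mul, sphereInt_C_mul, sphereInt_pderiv hF]
    push_cast
    ring
  have h2 : dirD y (linPoly y ^ n * p) =
      (n : MvPolynomial (Fin 3) ℝ) * (linPoly y ^ (n - 1) * p) + linPoly y ^ n * dirD y p := by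
    have hl : ∀ i, pderiv i (linPoly y) = C (y i) := fun i => by
      fin_cases i <;> simp [linPoly, Fin.sum_univ_three, pderiv_X]
    simp only [dirD_apply, Fin.sum_univ_three, pderiv_mul, pderiv_pow, hl]
    linear_combination (n : MvPolynomial (Fin 3) ℝ) * (linPoly y ^ (n - 1) * p) * hyC
  rw [← h1, h2, map_add, sphereInt_natCast_mul]

/-- Sphere moments and Legendre moments obey the same recursion, because Euler's identity gives
`dirD y p` the value `ℓ p(y)` at `y`. The induction runs over all `p` and `ℓ` at once, as `dirD y`
lowers the degree of `p`. -/
lemma sphereInt_linPoly_pow_mul (n : ℕ) : ∀ {p : MvPolynomial (Fin 3) ℝ} {ℓ : ℕ}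
    (_ : p ∈ harmonicSpace ℓ) {y : E3} (_ : ‖y‖ = 1), sphereInt (linPoly y ^ n * p) =
      2 * Real.pi * polyInt (Polynomial.X ^ n * legendreP ℓ) * polyFun p y := by
  induction n using Nat.strong_induction_on with
  | h n ih =>
    intro p ℓ hp y hy
    cases n with
    | zero =>
      simp only [pow_zero, one_mul]
      rw [polyInt_legendreP]
      split_ifs with h
      · subst h
        obtain ⟨a, rfl⟩ := exists_eq_C_of_mem_harmonicSpace_zero hp
        rw [sphereInt_C]
        simp only [polyFun, eval_C]
        ring
      · rw [sphereInt_of_mem_harmonicSpace hp h]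
        simp
    | succ n =>
      have h1 := sphereInt_linPoly_pow_succ_mul hp hy n
      have h2 := polyInt_X_pow_mul_legendreP n ℓ
      rw [ih n (Nat.lt_succ_self n) (dirD_mem_harmonicSpace hp y) hy, polyFun_dirD_self hp,
        ih (n - 1) (by lia) hp hy] at h1
      have h0 : (n : ℝ) + ℓ + 2 ≠ 0 := by positivity
      refine mul_left_cancel₀ h0 ?_
      rw [h1]
      linear_combination -(2 * Real.pi * polyFun p y) * h2

lemma polyFun_aeval_linPoly (q : Polynomial ℝ) (y x : E3) :
    polyFun (Polynomial.aeval (linPoly y) q) x = q.eval ⟪x, y⟫ := by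
  rw [← polyFun_linPoly y x]
  unfold polyFun
  rw [Polynomial.aeval_def, Polynomial.hom_eval₂]
  have : (eval x.ofLp).comp (algebraMap ℝ (MvPolynomial (Fin 3) ℝ)) = RingHom.id ℝ := by
    ext a; simp
  rw [this]
  rfl

/-- The Funk–Hecke formula for polynomial zonal functions. -/
theorem integral_zonal_mul_harmonic (q : Polynomial ℝ) {p : MvPolynomial (Fin 3) ℝ} {ℓ : ℕ}
    (hp : p ∈ harmonicSpace ℓ) {y : E3} (hy : ‖y‖ = 1) :
    ∫ x : S2, q.eval ⟪(x : E3), y⟫ * polyFun p x ∂surfaceMeasure =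
      2 * Real.pi * polyInt (q * legendreP ℓ) * polyFun p y := by
  have h : sphereInt (Polynomial.aeval (linPoly y) q * p) =
      2 * Real.pi * polyInt (q * legendreP ℓ) * polyFun p y := by
    induction q using Polynomial.induction_on' with
    | add q r hq hr => rw [map_add, add_mul, map_add, hq, hr, add_mul, map_add]; ring
    | monomial n a =>
      rw [← Polynomial.C_mul_X_pow_eq_monomial, mul_assoc (Polynomial.C a), Polynomial.C_mul',
        Polynomial.C_mul', map_smul, map_smul, map_pow, Polynomial.aeval_X, smul_mul_assoc, map_smul,
        sphereInt_linPoly_pow_mul n hp hy]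
      simp only [smul_eq_mul]
      ring
  rw [← h, sphereInt_apply]
  refine integral_congr_ae (Filter.Eventually.of_forall fun x => ?_)
  beta_reduce
  rw [← polyFun_aeval_linPoly]
  simp [polyFun]

end Harmonic

/-! ### Integration by parts for surface gradient and surface curl -/

section SurfaceCalculus

open MvPolynomial

lemma inner_eq_sum_three (u v : E3) : ⟪u, v⟫ = u 0 * v 0 + u 1 * v 1 + u 2 * v 2 := by
  simp [PiLp.inner_apply, Fin.sum_univ_three]
  ring

lemma cross_zero_apply (u v : E3) : cross u v 0 = u 1 * v 2 - u 2 * v 1 := by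
  simp [cross, cross_apply]

lemma cross_one_apply (u v : E3) : cross u v 1 = u 2 * v 0 - u 0 * v 2 := by
  simp [cross, cross_apply]

lemma cross_two_apply (u v : E3) : cross u v 2 = u 0 * v 1 - u 1 * v 0 := by
  simp [cross, cross_apply]

lemma inner_single_one (u : E3) (i : Fin 3) : ⟪u, EuclideanSpace.single i (1 : ℝ)⟫ = u i := by
  rw [EuclideanSpace.inner_single_right]
  simp

lemma gradient_apply (g : E3 → ℝ) (x : E3) (i : Fin 3) : gradient g x i = partialD i g x := by
  have : ⟪gradient g x, EuclideanSpace.single i (1 : ℝ)⟫ = partialD i g x := by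
    rw [gradient, InnerProductSpace.toDual_symm_apply, partialD]
  rw [← this, inner_single_one]

lemma integral_add_three {f g h : S2 → ℝ} (hf : Integrable f surfaceMeasure)
    (hg : Integrable g surfaceMeasure) (hh : Integrable h surfaceMeasure) :
    ∫ x, (f x + g x + h x) ∂surfaceMeasure =
      ∫ x, f x ∂surfaceMeasure + ∫ x, g x ∂surfaceMeasure + ∫ x, h x ∂surfaceMeasure := by
  rw [← integral_add hf hg]
  exact integral_add (hf.add hg) hh

/-- The components of `x × ∇g` are infinitesimal rotations of `g`, so each can be integrated by
parts. The Green and orthogonality formulas below come from particular choices of `p₀, p₁, p₂`. -/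
lemma integral_curl_component_mul {g : E3 → ℝ} (hg : ContDiff ℝ 1 g)
    (p₀ p₁ p₂ : MvPolynomial (Fin 3) ℝ) :
    ∫ x : S2, (surfaceCurl g x 0 * polyFun p₀ x + surfaceCurl g x 1 * polyFun p₁ x +
      surfaceCurl g x 2 * polyFun p₂ x) ∂surfaceMeasure =
      -∫ x : S2, g x * polyFun (rotD 1 2 p₀ + rotD 2 0 p₁ + rotD 0 1 p₂) x ∂surfaceMeasure := by
  have h0 := integral_rotation_mul_polyFun hg p₀ 1 2
  have h1 := integral_rotation_mul_polyFun hg p₁ 2 0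
  have h2 := integral_rotation_mul_polyFun hg p₂ 0 1
  have c := fun i => continuous_partialD hg i
  have d := continuous_polyFun
  have e := hg.continuous
  have i1 : ∀ (j k : Fin 3) (p : MvPolynomial (Fin 3) ℝ), Integrable (fun x : S2 =>
      ((x : E3) j * partialD k g x - (x : E3) k * partialD j g x) * polyFun p x) surfaceMeasure :=
    fun j k p => integrable_of_continuous (by fun_prop)
  have i2 : ∀ (p : MvPolynomial (Fin 3) ℝ), Integrable (fun x : S2 => g x * polyFun p x)
      surfaceMeasure := fun p => integrable_of_continuous (by fun_prop)
  simp only [surfaceCurl, cross_zero_apply, cross_one_apply, cross_two_apply, gradient_apply]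
  rw [integral_add_three (i1 _ _ _) (i1 _ _ _) (i1 _ _ _), h0,
    h1, h2]
  have : ∀ x : S2, g x * polyFun (rotD 1 2 p₀ + rotD 2 0 p₁ + rotD 0 1 p₂) x =
      g x * polyFun (rotD 1 2 p₀) x + g x * polyFun (rotD 2 0 p₁) x +
        g x * polyFun (rotD 0 1 p₂) x := fun x => by
    simp only [polyFun, map_add]; ring
  simp only [this]
  rw [integral_add_three (i2 _) (i2 _) (i2 _)]
  ring

/-- After integration by parts, second derivatives of `p` cancel by symmetry: `(x × ∇) · ∇p = 0`. -/
lemma integral_curl_component_mul_pderiv {g : E3 → ℝ} (hg : ContDiff ℝ 1 g)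
    (p : MvPolynomial (Fin 3) ℝ) :
    ∫ x : S2, (surfaceCurl g x 0 * polyFun (pderiv 0 p) x +
      surfaceCurl g x 1 * polyFun (pderiv 1 p) x +
      surfaceCurl g x 2 * polyFun (pderiv 2 p) x) ∂surfaceMeasure = 0 := by
  rw [integral_curl_component_mul hg]
  have : rotD 1 2 (pderiv 0 p) + rotD 2 0 (pderiv 1 p) + rotD 0 1 (pderiv 2 p) = 0 := by
    simp only [rotD_apply]
    linear_combination X 1 * pderiv_comm 2 0 p - X 2 * pderiv_comm 1 0 p - X 0 * pderiv_comm 2 1 p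
  rw [this]
  simp [polyFun]

/-- Surface gradients are orthogonal to surface curls of polynomials. -/
theorem integral_surfaceGradient_surfaceCurl {g : E3 → ℝ} (hg : ContDiff ℝ 1 g)
    (p : MvPolynomial (Fin 3) ℝ) :
    ∫ x : S2, ⟪surfaceGradient g x, surfaceCurl (polyFun p) x⟫ ∂surfaceMeasure = 0 := by
  -- Pointwise, `⟪∇g, x × ∇p⟫ = -⟪x × ∇g, ∇p⟫`, and the radial part of `∇g` is orthogonal to `x ×
  -- ∇p`.
  rw [← neg_eq_zero, ← integral_neg, ← integral_curl_component_mul_pderiv hg p]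
  refine integral_congr_ae (Filter.Eventually.of_forall fun x => ?_)
  simp only [inner_eq_sum_three, surfaceCurl, surfaceGradient, cross_zero_apply, cross_one_apply,
    cross_two_apply, gradient_apply, partialD_polyFun, PiLp.sub_apply, PiLp.smul_apply, smul_eq_mul]
  ring

/-- Surface curls are orthogonal to surface gradients of polynomials. -/
theorem integral_surfaceCurl_surfaceGradient {g : E3 → ℝ} (hg : ContDiff ℝ 1 g)
    (p : MvPolynomial (Fin 3) ℝ) :
    ∫ x : S2, ⟪surfaceCurl g x, surfaceGradient (polyFun p) x⟫ ∂surfaceMeasure = 0 := by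
  rw [← integral_curl_component_mul_pderiv hg p]
  refine integral_congr_ae (Filter.Eventually.of_forall fun x => ?_)
  simp only [inner_eq_sum_three, surfaceCurl, surfaceGradient, cross_zero_apply, cross_one_apply,
    cross_two_apply, gradient_apply, partialD_polyFun, PiLp.sub_apply, PiLp.smul_apply, smul_eq_mul]
  ring

/-- Green's formula for surface curls, tested against a spherical harmonic. -/
theorem integral_surfaceCurl_surfaceCurl {g : E3 → ℝ} (hg : ContDiff ℝ 1 g)
    {p : MvPolynomial (Fin 3) ℝ} {ℓ : ℕ} (hp : p ∈ harmonicSpace ℓ) :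
    ∫ x : S2, ⟪surfaceCurl g x, surfaceCurl (polyFun p) x⟫ ∂surfaceMeasure =
      (ℓ : ℝ) * (ℓ + 1) * ∫ x : S2, g x * polyFun p x ∂surfaceMeasure := by
  have h := integral_curl_component_mul hg (rotD 1 2 p) (rotD 2 0 p) (rotD 0 1 p)
  rw [sum_rotD_rotD hp] at h
  rw [← integral_const_mul]
  refine Eq.trans ?_ (h.trans ?_)
  · refine integral_congr_ae (Filter.Eventually.of_forall fun x => ?_)
    simp only [inner_eq_sum_three, surfaceCurl, cross_zero_apply, cross_one_apply,
      cross_two_apply, gradient_apply, partialD_polyFun, rotD_apply]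
    simp [polyFun]
  · rw [← integral_neg]
    refine integral_congr_ae (Filter.Eventually.of_forall fun x => ?_)
    simp [polyFun]
    ring

/-- Green's formula for surface gradients, tested against a spherical harmonic. -/
theorem integral_surfaceGradient_surfaceGradient {g : E3 → ℝ} (hg : ContDiff ℝ 1 g)
    {p : MvPolynomial (Fin 3) ℝ} {ℓ : ℕ} (hp : p ∈ harmonicSpace ℓ) :
    ∫ x : S2, ⟪surfaceGradient g x, surfaceGradient (polyFun p) x⟫ ∂surfaceMeasure =
      (ℓ : ℝ) * (ℓ + 1) * ∫ x : S2, g x * polyFun p x ∂surfaceMeasure := by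
  -- For `‖x‖ = 1` the map `x × ·` is an isometry of the tangent plane, so both integrands agree
  -- pointwise.
  rw [← integral_surfaceCurl_surfaceCurl hg hp]
  refine integral_congr_ae (Filter.Eventually.of_forall fun x => ?_)
  have hx := sum_sq_coord x
  simp only [inner_eq_sum_three, surfaceCurl, surfaceGradient, cross_zero_apply, cross_one_apply,
    cross_two_apply, PiLp.sub_apply, PiLp.smul_apply, smul_eq_mul]
  set u := gradient g (x : E3)
  set v := gradient (polyFun p) (x : E3)
  linear_combination (-(u 0 * v 0 + u 1 * v 1 + u 2 * v 2) +
    ((x : E3) 0 * u 0 + (x : E3) 1 * u 1 + (x : E3) 2 * u 2) *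
    ((x : E3) 0 * v 0 + (x : E3) 1 * v 1 + (x : E3) 2 * v 2)) * hx

lemma contDiff_zonal (q : Polynomial ℝ) (y : E3) {n : WithTop ℕ∞} :
    ContDiff ℝ n fun x : E3 => q.eval ⟪x, y⟫ :=
  (show ContDiff ℝ n fun t => q.eval t by simpa using q.contDiff_aeval (𝕜 := ℝ) n).comp
    (contDiff_id.inner ℝ contDiff_const)

lemma partialD_zonal (q : Polynomial ℝ) (x y : E3) (i : Fin 3) :
    partialD i (fun x : E3 => q.eval ⟪x, y⟫) x = q.derivative.eval ⟪x, y⟫ * y i := by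
  unfold partialD
  have h1 : HasFDerivAt (fun x : E3 => ⟪x, y⟫) (innerSL ℝ y) x := by
    have : (fun x : E3 => ⟪x, y⟫) = innerSL ℝ y := by ext x; simp [real_inner_comm]
    rw [this]
    exact (innerSL ℝ y).hasFDerivAt
  have h2 := (q.hasDerivAt ⟪x, y⟫).comp_hasFDerivAt x h1
  have h3 : (fun x : E3 => q.eval ⟪x, y⟫) = (fun t => q.eval t) ∘ fun x : E3 => ⟪x, y⟫ := rfl
  rw [h3, h2.fderiv]
  simp [inner_single_one]

/-- The differentiated Funk–Hecke formula. -/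
theorem integral_zonal_mul_inner_cross_mul_harmonic (G : Polynomial ℝ)
    {p : MvPolynomial (Fin 3) ℝ} {ℓ : ℕ} (hp : p ∈ harmonicSpace ℓ) {y : E3} (hy : ‖y‖ = 1)
    (a : E3) :
    ∫ x : S2, G.derivative.eval ⟪(x : E3), y⟫ * ⟪cross a y, (x : E3)⟫ * polyFun p x
      ∂surfaceMeasure =
      2 * Real.pi * polyInt (G * legendreP ℓ) * ⟪cross a y, gradient (polyFun p) y⟫ := by
  have hG := contDiff_zonal G y (n := 1)
  have d := (contDiff_zonal G.derivative y (n := 1)).continuous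
  -- The first factors are the rotational derivative of `G(⟪x, y⟫)`. Integration by parts moves it
  -- onto `p`; `rotD j k p` is again harmonic of degree `ℓ`, so Funk–Hecke applies with the same
  -- factor.
  have h : ∀ j k, ∫ x : S2, ((x : E3) j * y k - (x : E3) k * y j) *
      (G.derivative.eval ⟪(x : E3), y⟫ * polyFun p x) ∂surfaceMeasure =
      -(2 * Real.pi * polyInt (G * legendreP ℓ) * polyFun (rotD j k p) y) := fun j k => by
    have h := integral_rotation_mul_polyFun hG p j k
    rw [integral_zonal_mul_harmonic G (rotD_mem_harmonicSpace hp j k) hy] at h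
    rw [← h]
    refine integral_congr_ae (Filter.Eventually.of_forall fun x => ?_)
    simp only [partialD_zonal]
    ring
  have cp := continuous_polyFun p
  have i1 : ∀ (b : ℝ) (j k : Fin 3), Integrable (fun x : S2 => b * (((x : E3) j * y k - (x : E3) k * y j) *
      (G.derivative.eval ⟪(x : E3), y⟫ * polyFun p x))) surfaceMeasure := fun b j k =>
    integrable_of_continuous (by fun_prop)
  have e : ∀ x : S2, G.derivative.eval ⟪(x : E3), y⟫ * ⟪cross a y, (x : E3)⟫ * polyFun p x =
      (-a 0) * (((x : E3) 1 * y 2 - (x : E3) 2 * y 1) *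
        (G.derivative.eval ⟪(x : E3), y⟫ * polyFun p x)) +
      (-a 1) * (((x : E3) 2 * y 0 - (x : E3) 0 * y 2) *
        (G.derivative.eval ⟪(x : E3), y⟫ * polyFun p x)) +
      (-a 2) * (((x : E3) 0 * y 1 - (x : E3) 1 * y 0) *
        (G.derivative.eval ⟪(x : E3), y⟫ * polyFun p x)) := fun x => by
    rw [inner_eq_sum_three (cross a y), cross_zero_apply, cross_one_apply, cross_two_apply]
    ring
  simp only [e]
  rw [integral_add_three (i1 _ _ _) (i1 _ _ _) (i1 _ _ _)]
  simp only [integral_const_mul, h]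
  rw [inner_eq_sum_three (cross a y), cross_zero_apply, cross_one_apply, cross_two_apply]
  simp only [gradient_apply, partialD_polyFun, rotD_apply]
  simp only [polyFun, map_sub, map_mul, eval_X]
  ring

end SurfaceCalculus

/-! ### The auxiliary function `κ` -/

section Kappa

lemma continuous_kappa_integral {ψ : ℝ → ℝ} (hψ : Continuous ψ) :
    Continuous fun t => ∫ s in (-1 : ℝ)..t, (1 - 4 * Real.pi * ψ s) :=
  intervalIntegral.continuous_primitive
    (fun a b => (Continuous.intervalIntegrable (by fun_prop) a b)) _

lemma measurable_kappa {ψ : ℝ → ℝ} (hψ : Continuous ψ) : Measurable (kappa ψ) := by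
  have := (continuous_kappa_integral hψ).measurable
  unfold kappa
  fun_prop

/-- Differentiate `(1 - t²) κ(t)`. Keeping `κ` in the formula lets bounds on `κ` pass to `(1 - t²)
κ'`. -/
lemma hasDerivAt_kappa {ψ : ℝ → ℝ} (hψ : Continuous ψ) {t : ℝ} (h1 : -1 < t) (h2 : t < 1) :
    HasDerivAt (kappa ψ)
      (((4 * Real.pi)⁻¹ - ψ t + 2 * t * kappa ψ t) / (1 - t ^ 2)) t := by
  have h0 : 1 - t ^ 2 ≠ 0 := by nlinarith
  have hpi := Real.pi_ne_zero
  have hI : HasDerivAt (fun t => ∫ s in (-1 : ℝ)..t, (1 - 4 * Real.pi * ψ s))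
      (1 - 4 * Real.pi * ψ t) t :=
    intervalIntegral.integral_hasDerivAt_right (Continuous.intervalIntegrable (by fun_prop) _ _)
      (Continuous.stronglyMeasurableAtFilter (by fun_prop) _ _) (by fun_prop)
  have hD : HasDerivAt (fun t : ℝ => 4 * Real.pi * (1 - t ^ 2)) (4 * Real.pi * (-(2 * t))) t := by
    simpa using ((hasDerivAt_pow 2 t).const_sub 1).const_mul (4 * Real.pi)
  refine ((hD.inv (by positivity)).mul hI).congr_deriv ?_
  unfold kappa
  simp only [Pi.inv_apply]
  field_simp
  ring

/-- Stability of `κ` and `κ'` under uniform perturbations of the zonal kernel. -/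
lemma abs_kappa_sub_le {ψ₁ ψ₂ : ℝ → ℝ} (h₁ : Continuous ψ₁) (h₂ : Continuous ψ₂)
    (hint : ∫ t in (-1 : ℝ)..1, ψ₁ t = ∫ t in (-1 : ℝ)..1, ψ₂ t) {ε : ℝ}
    (hε : ∀ t ∈ Icc (-1 : ℝ) 1, |ψ₁ t - ψ₂ t| ≤ ε) {t : ℝ} (ht : t ∈ Icc (-1 : ℝ) 1) :
    |kappa ψ₁ t - kappa ψ₂ t| ≤ ε ∧
      (1 - t ^ 2) * |deriv (kappa ψ₁) t - deriv (kappa ψ₂) t| ≤ 3 * ε := by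
  have hε0 : 0 ≤ ε := (abs_nonneg _).trans (hε t ht)
  -- At `t = ±1` the convention `0⁻¹ = 0` makes both `κ` vanish.
  by_cases ht' : 1 - t ^ 2 = 0
  · simp [kappa, ht', hε0]
  have hlt : 0 < 1 - t ^ 2 := lt_of_le_of_ne (by nlinarith [ht.1, ht.2]) (Ne.symm ht')
  have t1 : -1 < t := by
    by_contra h
    exact ht' (by rw [le_antisymm (not_lt.1 h) ht.1]; norm_num)
  have t2 : t < 1 := by
    by_contra h
    exact ht' (by rw [le_antisymm ht.2 (not_lt.1 h)]; norm_num)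
  have i1 := fun a b : ℝ => h₁.intervalIntegrable (μ := volume) a b
  have i2 := fun a b : ℝ => h₂.intervalIntegrable (μ := volume) a b
  set D := ∫ s in (-1 : ℝ)..t, (ψ₁ s - ψ₂ s) with hD
  have hk : kappa ψ₁ t - kappa ψ₂ t = -(1 - t ^ 2)⁻¹ * D := by
    have hpi := Real.pi_ne_zero
    unfold kappa
    rw [← mul_sub, ← intervalIntegral.integral_sub
      (Continuous.intervalIntegrable (by fun_prop) _ _)
      (Continuous.intervalIntegrable (by fun_prop) _ _)]
    have : (fun s => 1 - 4 * Real.pi * ψ₁ s - (1 - 4 * Real.pi * ψ₂ s)) =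
        fun s => (-(4 * Real.pi)) * (ψ₁ s - ψ₂ s) := by ext s; ring
    rw [this, intervalIntegral.integral_const_mul, ← hD]
    field_simp
  -- Equal masses allow `D` to be integrated from either endpoint. Hence `|D| ≤ ε (1 - |t|) ≤ ε (1 -
  -- t²)`, which cancels the singular factor at both poles.
  have hD2 : D = -∫ s in t..(1 : ℝ), (ψ₁ s - ψ₂ s) := by
    rw [eq_neg_iff_add_eq_zero, hD, intervalIntegral.integral_add_adjacent_intervals
      ((i1 _ _).sub (i2 _ _)) ((i1 _ _).sub (i2 _ _)), intervalIntegral.integral_sub (i1 _ _) (i2 _ _),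
      hint, sub_self]
  have b1 : |D| ≤ ε * (1 + t) := by
    have := intervalIntegral.norm_integral_le_of_norm_le_const (a := (-1 : ℝ)) (b := t)
      (f := fun s => ψ₁ s - ψ₂ s) (C := ε) fun s hs => by
        rw [uIoc_of_le t1.le] at hs
        exact hε s ⟨hs.1.le, hs.2.trans t2.le⟩
    rw [Real.norm_eq_abs] at this
    rwa [sub_neg_eq_add, add_comm t, abs_of_pos (show 0 < 1 + t by linarith)] at this
  have b2 : |D| ≤ ε * (1 - t) := by
    have := intervalIntegral.norm_integral_le_of_norm_le_const (a := t) (b := (1 : ℝ))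
      (f := fun s => ψ₁ s - ψ₂ s) (C := ε) fun s hs => by
        rw [uIoc_of_le t2.le] at hs
        exact hε s ⟨t1.le.trans hs.1.le, hs.2⟩
    rw [Real.norm_eq_abs] at this
    rwa [abs_of_pos (show 0 < 1 - t by linarith), ← abs_neg, ← hD2] at this
  have hDb : |D| ≤ ε * (1 - t ^ 2) := by
    rcases le_total t 0 with h | h
    · exact b1.trans (mul_le_mul_of_nonneg_left (by nlinarith) hε0)
    · exact b2.trans (mul_le_mul_of_nonneg_left (by nlinarith) hε0)
  have hkb : |kappa ψ₁ t - kappa ψ₂ t| ≤ ε := by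
    rw [hk, abs_mul, abs_neg, abs_inv, abs_of_pos hlt, inv_mul_le_iff₀ hlt, mul_comm]
    exact hDb
  refine ⟨hkb, ?_⟩
  rw [(hasDerivAt_kappa h₁ t1 t2).deriv, (hasDerivAt_kappa h₂ t1 t2).deriv, ← sub_div, abs_div,
    abs_of_pos hlt, mul_div_cancel₀ _ hlt.ne']
  have e : (4 * Real.pi)⁻¹ - ψ₁ t + 2 * t * kappa ψ₁ t - ((4 * Real.pi)⁻¹ - ψ₂ t +
      2 * t * kappa ψ₂ t) = 2 * t * (kappa ψ₁ t - kappa ψ₂ t) - (ψ₁ t - ψ₂ t) := by ring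
  rw [e]
  refine (abs_sub _ _).trans ?_
  rw [abs_mul, abs_mul, abs_two]
  have ht1 : |t| ≤ 1 := abs_le.2 ht
  have := mul_le_mul ht1 hkb (abs_nonneg _) zero_le_one
  have := hε t ht
  linarith

lemma kappa_const : kappa (fun _ => (4 * Real.pi)⁻¹) = fun _ => 0 := by
  have := Real.pi_ne_zero
  have h : 4 * Real.pi * (4 * Real.pi)⁻¹ = 1 := by field_simp
  ext t
  simp only [kappa, h, sub_self, intervalIntegral.integral_zero, mul_zero]

lemma exists_derivative_eq (p : Polynomial ℝ) : ∃ G : Polynomial ℝ, G.derivative = p := by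
  induction p using Polynomial.induction_on' with
  | add p q hp hq =>
    obtain ⟨F, rfl⟩ := hp
    obtain ⟨G, rfl⟩ := hq
    exact ⟨F + G, by simp⟩
  | monomial n a =>
    refine ⟨Polynomial.monomial (n + 1) (a / (n + 1)), ?_⟩
    rw [Polynomial.derivative_monomial]
    have : (n : ℝ) + 1 ≠ 0 := by positivity
    congr 1
    push_cast
    field_simp

open Polynomial in
/-- For a polynomial zonal kernel of mass one, `κ` is the derivative of a polynomial. -/
lemma exists_polynomial_kappa {r : ℝ[X]} (hr : polyInt r = (2 * Real.pi)⁻¹) :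
    ∃ G : ℝ[X], derivative ((1 - X ^ 2) * derivative G) = C (4 * Real.pi)⁻¹ - r ∧
      ∀ t, -1 < t → t < 1 → kappa (fun t => r.eval t) t = (derivative G).eval t ∧
        deriv (kappa fun t => r.eval t) t = (derivative (derivative G)).eval t := by
  have hpi := Real.pi_ne_zero
  obtain ⟨H₀, hH₀⟩ := exists_derivative_eq (C (4 * Real.pi)⁻¹ - r)
  set H := H₀ - C (H₀.eval (-1)) with hHdef
  have hH : derivative H = C (4 * Real.pi)⁻¹ - r := by simp [hHdef, hH₀]
  have hm : H.eval (-1) = 0 := by simp [hHdef]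
  -- The mass condition makes the primitive vanish at `1` as well as at `-1`. So `1 - X²` divides
  -- it, and the quotient is `κ`.
  have hp : H.eval 1 = 0 := by
    have h := polyInt_derivative H
    rw [hH, map_sub, hr, hm] at h
    have : polyInt (C (4 * Real.pi)⁻¹) = (2 * Real.pi)⁻¹ := by
      simp [polyInt]; field_simp; norm_num
    rw [this] at h
    linarith
  obtain ⟨A, hA⟩ := dvd_iff_isRoot.2 hp
  have hA1 : A.eval (-1) = 0 := by
    rw [hA] at hm
    simp at hm
    rcases hm with hm | hm
    · norm_num at hm
    · exact hm
  obtain ⟨B, hB⟩ := dvd_iff_isRoot.2 hA1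
  obtain ⟨G, hG⟩ := exists_derivative_eq (-B)
  have hHG : (1 - X ^ 2) * derivative G = H := by
    rw [hG, hA, hB]
    simp
    ring
  refine ⟨G, by rw [hHG, hH], ?_⟩
  have key : ∀ t, -1 < t → t < 1 → kappa (fun t => r.eval t) t = (derivative G).eval t := by
    intro t h1 h2
    have h0 : 1 - t ^ 2 ≠ 0 := by nlinarith
    have hI : ∫ s in (-1 : ℝ)..t, (1 - 4 * Real.pi * r.eval s) = 4 * Real.pi * H.eval t := by
      have := intervalIntegral.integral_eq_sub_of_hasDerivAt (a := -1) (b := t)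
        (f := fun t => 4 * Real.pi * H.eval t) (f' := fun s => 1 - 4 * Real.pi * r.eval s)
        (fun s _ => by
          refine ((H.hasDerivAt s).const_mul (4 * Real.pi)).congr_deriv ?_
          rw [hH]
          simp
          field_simp)
        (Continuous.intervalIntegrable (by fun_prop) _ _)
      rw [this, hm]
      ring
    unfold kappa
    rw [hI, ← hHG]
    simp
    field_simp
  intro t h1 h2
  refine ⟨key t h1 h2, ?_⟩
  have : kappa (fun t => r.eval t) =ᶠ[nhds t] fun t => (derivative G).eval t := by
    filter_upwards [Ioo_mem_nhds h1 h2] with s hs using key s hs.1 hs.2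
  rw [this.deriv_eq]
  exact Polynomial.deriv _

/-- Uniform approximation of a zonal kernel by polynomials of the same mean. -/
lemma exists_polynomial_approx {ψ : ℝ → ℝ} (hψ : Continuous ψ) {ε : ℝ} (hε : 0 < ε) :
    ∃ r : Polynomial ℝ, polyInt r = ∫ t in (-1 : ℝ)..1, ψ t ∧
      ∀ t ∈ Icc (-1 : ℝ) 1, |ψ t - r.eval t| ≤ ε := by
  obtain ⟨p, hp⟩ := exists_polynomial_near_of_continuousOn (-1) 1 ψ hψ.continuousOn (ε / 2)
    (half_pos hε)
  -- The constant that corrects the mean of `p` over an interval of length `2`; it costs at most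
  -- another `ε / 2`.
  set a := ((∫ t in (-1 : ℝ)..1, ψ t) - polyInt p) / 2 with ha
  have hC : polyInt (Polynomial.C a) = 2 * a := by
    simp [polyInt]; norm_num
  have hab : |a| ≤ ε / 2 := by
    have h1 : (∫ t in (-1 : ℝ)..1, ψ t) - polyInt p = ∫ t in (-1 : ℝ)..1, (ψ t - p.eval t) :=
      (intervalIntegral.integral_sub (hψ.intervalIntegrable _ _)
        (p.continuous.intervalIntegrable _ _)).symm
    have h2 := intervalIntegral.norm_integral_le_of_norm_le_const (a := (-1 : ℝ)) (b := 1)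
      (f := fun s => ψ s - p.eval s) (C := ε / 2) fun s hs => by
        rw [uIoc_of_le (by norm_num)] at hs
        rw [Real.norm_eq_abs, abs_sub_comm]
        exact (hp s ⟨hs.1.le, hs.2⟩).le
    rw [← h1, Real.norm_eq_abs] at h2
    norm_num at h2
    rw [ha, abs_div, abs_two]
    linarith
  refine ⟨p + Polynomial.C a, ?_, fun t ht => ?_⟩
  · rw [map_add, hC, ha]; ring
  · have h1 := hp t ht
    rw [abs_sub_comm] at h1
    rw [Polynomial.eval_add, Polynomial.eval_C, ← sub_sub]
    refine (abs_sub _ _).trans ?_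
    linarith

lemma inner_mem_Icc (x y : S2) : ⟪(x : E3), (y : E3)⟫ ∈ Icc (-1 : ℝ) 1 := by
  have := abs_real_inner_le_norm (x : E3) y
  simp at this
  exact abs_le.1 this

/-- Integrals of zonal functions over the sphere. -/
lemma integral_zonal {ψ : ℝ → ℝ} (hψ : Continuous ψ) (y : S2) :
    ∫ x : S2, ψ ⟪(x : E3), (y : E3)⟫ ∂surfaceMeasure = 2 * Real.pi * ∫ t in (-1 : ℝ)..1, ψ t := by
  rw [← sub_eq_zero, ← abs_nonpos_iff]
  refine le_of_forall_pos_le_add fun ε hε => ?_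
  have hpi := Real.pi_pos
  obtain ⟨r, hr, hrb⟩ := exists_polynomial_approx hψ (ε := ε / (4 * Real.pi)) (by positivity)
  have h1 := integral_zonal_mul_harmonic r (p := 1) (ℓ := 0) (y := y)
    (Submodule.mem_inf.2 ⟨MvPolynomial.isHomogeneous_one _ _, by simp [polyLaplacian]⟩) (by simp)
  simp only [polyFun, map_one, mul_one, legendreP_zero] at h1
  rw [← hr, ← h1, ← integral_sub]
  · refine (norm_integral_le_of_norm_le_const (μ := surfaceMeasure)
      (f := fun x : S2 => ψ ⟪(x : E3), (y : E3)⟫ - r.eval ⟪(x : E3), (y : E3)⟫)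
      (C := ε / (4 * Real.pi)) (Filter.Eventually.of_forall fun x => hrb _ (inner_mem_Icc x y))).trans ?_
    rw [surfaceMeasure_real_univ]
    field_simp
    simp
  · exact integrable_of_continuous (by fun_prop)
  · exact integrable_of_continuous (by fun_prop)

end Kappa

/-! ### The matrix-valued kernels applied to a vector -/

section ZonalKernel

/-- The vector multiplying `κ'` in the sum of the two kernels applied to `e`. -/
noncomputable def kernelA (x y e : E3) : E3 :=
  ⟪x - ⟪x, y⟫ • y, e⟫ • (y - ⟪x, y⟫ • x) - ⟪cross x y, e⟫ • cross x y

/-- The vector multiplying `κ` in the sum of the two kernels applied to `e`. -/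
noncomputable def kernelB (x y e : E3) : E3 :=
  ⟪x, y⟫ • e - ⟪x, e⟫ • y + (e - ⟪y, e⟫ • y - ⟪x, e - ⟪y, e⟫ • y⟫ • x)

/-- The sum of the divergence-free and the curl-free kernel applied to `e`. -/
noncomputable def zonalKernel (ψ : ℝ → ℝ) (x y e : E3) : E3 :=
  deriv (kappa ψ) ⟪x, y⟫ • kernelA x y e + kappa ψ ⟪x, y⟫ • kernelB x y e

lemma toLp_mulVec_eq_zonalKernel (ψ : ℝ → ℝ) (x y e : E3) :
    WithLp.toLp 2 ((divKernel ψ x y + curlKernel ψ x y).mulVec e.ofLp) = zonalKernel ψ x y e := by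
  unfold zonalKernel divKernel curlKernel kernelA kernelB
  generalize deriv (kappa ψ) ⟪x, y⟫ = k'
  generalize kappa ψ ⟪x, y⟫ = k
  ext i
  fin_cases i <;>
  · simp [Matrix.mulVec, dotProduct, Fin.sum_univ_three, Matrix.vecMulVec_apply, Matrix.mul_apply,
      inner_eq_sum_three, cross_zero_apply, cross_one_apply, cross_two_apply, Matrix.one_apply]
    ring

lemma measurable_cross {X : Type*} [MeasurableSpace X] {u v : X → E3} (hu : Measurable u)
    (hv : Measurable v) : Measurable fun z => cross (u z) (v z) :=
  (continuous_cross continuous_fst continuous_snd).measurable.comp (hu.prodMk hv)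

lemma measurable_zonalKernel {ψ : ℝ → ℝ} (hψ : Continuous ψ) {X : Type*} [MeasurableSpace X]
    {u v w : X → E3} (hu : Measurable u) (hv : Measurable v) (hw : Measurable w) :
    Measurable fun z => zonalKernel ψ (u z) (v z) (w z) := by
  have h1 := measurable_cross hu hv
  have hi : Measurable fun z => ⟪u z, v z⟫ := Measurable.inner hu hv
  have hA : Measurable fun z => kernelA (u z) (v z) (w z) := by unfold kernelA; fun_prop
  have hB : Measurable fun z => kernelB (u z) (v z) (w z) := by unfold kernelB; fun_prop
  exact (((measurable_deriv (kappa ψ)).comp hi).smul hA).add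
    (((measurable_kappa hψ).comp hi).smul hB)

/-- The vectors `x - t y`, `y - t x` and `x × y` all have length `√(1 - t²)`. The resulting factor
`1 - t²` absorbs the singularity of `κ'`. -/
lemma norm_kernelA_le {x y : E3} (hx : ‖x‖ = 1) (hy : ‖y‖ = 1) (e : E3) :
    ‖kernelA x y e‖ ≤ 2 * (1 - ⟪x, y⟫ ^ 2) * ‖e‖ := by
  have hx' : x 0 ^ 2 + x 1 ^ 2 + x 2 ^ 2 = 1 := sum_sq_coord ⟨x, by simpa using hx⟩
  have hy' : y 0 ^ 2 + y 1 ^ 2 + y 2 ^ 2 = 1 := sum_sq_coord ⟨y, by simpa using hy⟩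
  have h1 : ‖x - ⟪x, y⟫ • y‖ ^ 2 = 1 - ⟪x, y⟫ ^ 2 := by
    rw [norm_sub_sq_real, inner_smul_right, norm_smul, hx, hy, Real.norm_eq_abs, mul_one, sq_abs]
    ring
  have h2 : ‖y - ⟪x, y⟫ • x‖ ^ 2 = 1 - ⟪x, y⟫ ^ 2 := by
    rw [norm_sub_sq_real, inner_smul_right, norm_smul, hx, hy, Real.norm_eq_abs, mul_one, sq_abs,
      real_inner_comm]
    ring
  have h3 : ‖cross x y‖ ^ 2 = 1 - ⟪x, y⟫ ^ 2 := by
    rw [EuclideanSpace.real_norm_sq_eq, Fin.sum_univ_three, cross_zero_apply, cross_one_apply,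
      cross_two_apply, inner_eq_sum_three]
    linear_combination (y 0 ^ 2 + y 1 ^ 2 + y 2 ^ 2) * hx' + hy'
  set s := 1 - ⟪x, y⟫ ^ 2
  have h4 : ‖x - ⟪x, y⟫ • y‖ = ‖cross x y‖ :=
    (pow_left_inj₀ (norm_nonneg _) (norm_nonneg _) two_ne_zero).1 (h1.trans h3.symm)
  have h5 : ‖y - ⟪x, y⟫ • x‖ = ‖cross x y‖ :=
    (pow_left_inj₀ (norm_nonneg _) (norm_nonneg _) two_ne_zero).1 (h2.trans h3.symm)
  unfold kernelA
  refine (norm_sub_le _ _).trans ?_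
  rw [norm_smul, norm_smul, h5]
  have e1 := norm_inner_le_norm (𝕜 := ℝ) (x - ⟪x, y⟫ • y) e
  have e2 := norm_inner_le_norm (𝕜 := ℝ) (cross x y) e
  rw [h4] at e1
  have f1 := mul_le_mul_of_nonneg_right e1 (norm_nonneg (cross x y))
  have f2 := mul_le_mul_of_nonneg_right e2 (norm_nonneg (cross x y))
  calc _ ≤ ‖cross x y‖ * ‖e‖ * ‖cross x y‖ + ‖cross x y‖ * ‖e‖ * ‖cross x y‖ := add_le_add f1 f2
    _ = 2 * ‖cross x y‖ ^ 2 * ‖e‖ := by ring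
    _ = _ := by rw [h3]

lemma norm_kernelB_le {x y : E3} (hx : ‖x‖ = 1) (hy : ‖y‖ = 1) (e : E3) :
    ‖kernelB x y e‖ ≤ 6 * ‖e‖ := by
  have h : ∀ u v w : E3, ‖u‖ = 1 → ‖w‖ = 1 → ‖⟪u, v⟫ • w‖ ≤ ‖v‖ := fun u v w hu hw => by
    rw [norm_smul, hw, mul_one]
    simpa [hu] using norm_inner_le_norm (𝕜 := ℝ) u v
  have h1 : ‖⟪x, y⟫ • e‖ ≤ ‖e‖ := by
    rw [norm_smul]
    have := norm_inner_le_norm (𝕜 := ℝ) x y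
    rw [hx, hy, mul_one] at this
    exact mul_le_of_le_one_left (norm_nonneg _) this
  have h2 : ‖e - ⟪y, e⟫ • y‖ ≤ 2 * ‖e‖ :=
    (norm_sub_le _ _).trans (by linarith [h y e y hy hy])
  have h3 := h x (e - ⟪y, e⟫ • y) x hx hx
  have h4 := h x e y hx hy
  unfold kernelB
  refine (norm_add_le _ _).trans ?_
  have h5 := norm_sub_le (⟪x, y⟫ • e) (⟪x, e⟫ • y)
  have h6 := norm_sub_le (e - ⟪y, e⟫ • y) (⟪x, e - ⟪y, e⟫ • y⟫ • x)
  linarith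

/-- The constant is `2 · 3` from the `κ'` term plus `6` from the `κ` term. -/
lemma norm_zonalKernel_sub_le {ψ₁ ψ₂ : ℝ → ℝ} (h₁ : Continuous ψ₁) (h₂ : Continuous ψ₂)
    (hint : ∫ t in (-1 : ℝ)..1, ψ₁ t = ∫ t in (-1 : ℝ)..1, ψ₂ t) {ε : ℝ}
    (hε : ∀ t ∈ Icc (-1 : ℝ) 1, |ψ₁ t - ψ₂ t| ≤ ε) (x y : S2) (e : E3) :
    ‖zonalKernel ψ₁ x y e - zonalKernel ψ₂ x y e‖ ≤ 12 * ε * ‖e‖ := by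
  have hx : ‖(x : E3)‖ = 1 := by simp
  have hy : ‖(y : E3)‖ = 1 := by simp
  obtain ⟨hk, hk'⟩ := abs_kappa_sub_le h₁ h₂ hint hε (inner_mem_Icc x y)
  have hsplit : zonalKernel ψ₁ x y e - zonalKernel ψ₂ x y e =
      (deriv (kappa ψ₁) ⟪(x : E3), (y : E3)⟫ - deriv (kappa ψ₂) ⟪(x : E3), (y : E3)⟫) •
        kernelA x y e +
      (kappa ψ₁ ⟪(x : E3), (y : E3)⟫ - kappa ψ₂ ⟪(x : E3), (y : E3)⟫) • kernelB x y e := by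
    unfold zonalKernel; module
  rw [hsplit]
  refine (norm_add_le _ _).trans ?_
  rw [norm_smul, norm_smul, Real.norm_eq_abs, Real.norm_eq_abs]
  have a1 := mul_le_mul_of_nonneg_left (norm_kernelA_le hx hy e)
    (abs_nonneg (deriv (kappa ψ₁) ⟪(x : E3), (y : E3)⟫ - deriv (kappa ψ₂) ⟪(x : E3), (y : E3)⟫))
  have a2 := mul_le_mul hk (norm_kernelB_le hx hy e) (norm_nonneg _) ((abs_nonneg _).trans hk)
  have a3 := mul_le_mul_of_nonneg_right hk' (norm_nonneg e)
  linarith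

lemma zonalKernel_const (x y e : E3) : zonalKernel (fun _ => (4 * Real.pi)⁻¹) x y e = 0 := by
  rw [zonalKernel, kappa_const]
  simp

/-- Stability relative to the constant kernel `(4π)⁻¹`, which has the same mass and whose matrix
kernel is zero. -/
lemma norm_zonalKernel_le {ψ : ℝ → ℝ} (hψ : Continuous ψ)
    (hint : ∫ t in (-1 : ℝ)..1, ψ t = (2 * Real.pi)⁻¹) :
    ∃ M, 0 ≤ M ∧ ∀ (x y : S2) (e : E3), ‖zonalKernel ψ x y e‖ ≤ M * ‖e‖ := by
  obtain ⟨ε, hε⟩ := (isCompact_Icc (a := (-1 : ℝ)) (b := 1)).exists_bound_of_continuousOn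
    (f := fun t => ψ t - (4 * Real.pi)⁻¹) (by fun_prop)
  have hε0 : 0 ≤ ε := (norm_nonneg _).trans (hε 0 (by simp))
  refine ⟨12 * ε, by positivity, fun x y e => ?_⟩
  have := norm_zonalKernel_sub_le hψ (continuous_const (y := (4 * Real.pi)⁻¹))
    (by rw [hint]; simp; field_simp; norm_num) hε x y e
  rwa [zonalKernel_const, sub_zero] at this

lemma inner_self_zonalKernel (ψ : ℝ → ℝ) {x : E3} (hx : ‖x‖ = 1) (y e : E3) :
    ⟪x, zonalKernel ψ x y e⟫ = 0 := by
  have hc : ⟪x, cross x y⟫ = 0 := by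
    rw [inner_eq_sum_three, cross_zero_apply, cross_one_apply, cross_two_apply]; ring
  simp only [zonalKernel, kernelA, kernelB, inner_add_right, inner_sub_right, inner_smul_right, hc,
    real_inner_self_eq_norm_sq, hx]
  ring

/-- The exceptional points are `±y`, and the cone over them lies in a line, which is null in `ℝ³`.
-/
lemma ae_inner_mem_Ioo (y : S2) :
    ∀ᵐ x : S2 ∂surfaceMeasure, ⟪(x : E3), (y : E3)⟫ ∈ Ioo (-1 : ℝ) 1 := by
  have hm : MeasurableSet {x : S2 | ⟪(x : E3), (y : E3)⟫ ∈ Ioo (-1 : ℝ) 1}ᶜ :=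
    ((isOpen_Ioo.preimage (f := fun x : S2 => ⟪(x : E3), (y : E3)⟫) (by fun_prop)).measurableSet).compl
  rw [ae_iff]
  change surfaceMeasure {x : S2 | ⟪(x : E3), (y : E3)⟫ ∈ Ioo (-1 : ℝ) 1}ᶜ = 0
  rw [Measure.toSphere_apply' _ hm]
  refine mul_eq_zero_of_right _ (measure_mono_null (t := (Submodule.span ℝ {(y : E3)} : Set E3)) ?_ ?_)
  · rintro _ ⟨r, -, _, ⟨x, hx, rfl⟩, rfl⟩
    refine Submodule.smul_mem _ r ?_
    have h1 : ⟪(x : E3), (y : E3)⟫ ^ 2 = 1 := by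
      have h2 := inner_mem_Icc x y
      simp only [mem_compl_iff, mem_ofPred_eq, mem_Ioo, not_and_or, not_lt] at hx
      rcases hx with hx | hx
      · rw [le_antisymm hx h2.1]; norm_num
      · rw [le_antisymm h2.2 hx]; norm_num
    have h3 : ‖(x : E3) - ⟪(x : E3), (y : E3)⟫ • (y : E3)‖ ^ 2 = 0 := by
      rw [norm_sub_sq_real, inner_smul_right, norm_smul, Real.norm_eq_abs, mul_pow, sq_abs]
      simp
      linarith
    have h4 := sub_eq_zero.1 (norm_eq_zero.1 (pow_eq_zero_iff two_ne_zero |>.1 h3))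
    rw [h4]
    exact Submodule.smul_mem _ _ (Submodule.mem_span_singleton_self _)
  · refine Measure.addHaar_submodule _ _ fun h => ?_
    have h1 := finrank_span_le_card (R := ℝ) ({(y : E3)} : Set E3)
    rw [h, finrank_top] at h1
    simp at h1

end ZonalKernel

/-! ### Vector spherical harmonics as eigenfunctions of the convolution -/

section Eigen

lemma gradient_zonal_mul_inner (q : Polynomial ℝ) (x y w : E3) :
    gradient (fun x : E3 => q.eval ⟪x, y⟫ * ⟪x, w⟫) x =
      (q.derivative.eval ⟪x, y⟫ * ⟪x, w⟫) • y + q.eval ⟪x, y⟫ • w := by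
  ext i
  have h := partialD_zonal Polynomial.X x w i
  simp only [Polynomial.eval_X, Polynomial.derivative_X, Polynomial.eval_one, one_mul] at h
  have hd : Differentiable ℝ fun x : E3 => ⟪x, w⟫ :=
    ((contDiff_id.inner ℝ contDiff_const : ContDiff ℝ 1 fun x : E3 => ⟪x, w⟫)).differentiable
      one_ne_zero
  rw [gradient_apply, partialD_mul ((contDiff_zonal q y (n := 1)).differentiable one_ne_zero) hd,
    partialD_zonal, h]
  simp
  ring

lemma contDiff_zonal_mul_inner (q : Polynomial ℝ) (y w : E3) {n : WithTop ℕ∞} :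
    ContDiff ℝ n fun x : E3 => q.eval ⟪x, y⟫ * ⟪x, w⟫ :=
  (contDiff_zonal q y).mul (contDiff_id.inner ℝ contDiff_const)

/-- If `q = G'`, the two scalar functions are the derivatives of `G(⟪x, y⟫)` in `y` along the
tangential directions `e × y` and `e - ⟪y, e⟫ y`. This realises the matrix kernels as mixed curl and
gradient derivatives of one zonal function. -/
lemma surfaceCurl_add_surfaceGradient_eq (q : Polynomial ℝ) (x y e : E3) :
    surfaceCurl (fun x : E3 => q.eval ⟪x, y⟫ * ⟪x, cross e y⟫) x +
      surfaceGradient (fun x : E3 => q.eval ⟪x, y⟫ * ⟪x, e - ⟪y, e⟫ • y⟫) x =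
      q.derivative.eval ⟪x, y⟫ • kernelA x y e + q.eval ⟪x, y⟫ • kernelB x y e := by
  unfold surfaceCurl surfaceGradient
  rw [gradient_zonal_mul_inner, gradient_zonal_mul_inner]
  unfold kernelA kernelB
  generalize hk' : q.derivative.eval ⟪x, y⟫ = k'
  generalize hk : q.eval ⟪x, y⟫ = k
  have h1 : cross x ((k' * ⟪x, cross e y⟫) • y + k • cross e y) =
      -(k' * ⟪cross x y, e⟫) • cross x y + k • (⟪x, y⟫ • e - ⟪x, e⟫ • y) := by
    ext i
    fin_cases i <;>
    · simp [cross_zero_apply, cross_one_apply, cross_two_apply, inner_eq_sum_three]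
      ring
  rw [h1]
  have h2 : ⟪x - ⟪x, y⟫ • y, e⟫ = ⟪x, e - ⟪y, e⟫ • y⟫ := by
    simp only [inner_sub_left, inner_sub_right, inner_smul_left, inner_smul_right]
    simp
    ring
  rw [h2, inner_add_right, inner_smul_right, inner_smul_right]
  module

lemma integral_inner_add {a b v : S2 → E3} (ha : Continuous a) (hb : Continuous b)
    (hv : Continuous v) : ∫ x, ⟪a x + b x, v x⟫ ∂surfaceMeasure =
      ∫ x, ⟪a x, v x⟫ ∂surfaceMeasure + ∫ x, ⟪b x, v x⟫ ∂surfaceMeasure := by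
  rw [← integral_add (integrable_of_continuous (ha.inner hv)) (integrable_of_continuous (hb.inner hv))]
  simp only [inner_add_left]

/-- Writes the tangential part of `e` as `cross a y`, so that one moment formula serves curls and
gradients. -/
lemma cross_cross_self {y : E3} (hy : ‖y‖ = 1) (e : E3) :
    cross (cross y e) y = e - ⟪y, e⟫ • y := by
  have hy' : y 0 ^ 2 + y 1 ^ 2 + y 2 ^ 2 = 1 := sum_sq_coord ⟨y, by simpa using hy⟩
  ext i
  fin_cases i
  · simp [cross_zero_apply, cross_one_apply, cross_two_apply, inner_eq_sum_three]
    linear_combination e 0 * hy'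
  · simp [cross_zero_apply, cross_one_apply, cross_two_apply, inner_eq_sum_three]
    linear_combination e 1 * hy'
  · simp [cross_zero_apply, cross_one_apply, cross_two_apply, inner_eq_sum_three]
    linear_combination e 2 * hy'

lemma continuous_surfaceCurl_polyFun (p : MvPolynomial (Fin 3) ℝ) :
    Continuous fun x : S2 => surfaceCurl (polyFun p) x :=
  continuous_surfaceCurl (contDiff_polyFun p)

lemma continuous_surfaceGradient_polyFun (p : MvPolynomial (Fin 3) ℝ) :
    Continuous fun x : S2 => surfaceGradient (polyFun p) x :=
  continuous_surfaceGradient (contDiff_polyFun p)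

lemma legendreCoeff_polynomial (r : Polynomial ℝ) (ℓ : ℕ) :
    legendreCoeff (fun t => r.eval t) ℓ = 2 * Real.pi * polyInt (r * legendreP ℓ) := by
  simp [legendreCoeff, polyInt]

/-- The action of a polynomial kernel of mass one on the vector spherical harmonics. -/
lemma integral_zonalKernel_polynomial {r : Polynomial ℝ} (hr : polyInt r = (2 * Real.pi)⁻¹)
    {p : MvPolynomial (Fin 3) ℝ} {ℓ : ℕ} (hp : p ∈ harmonicSpace ℓ) (hℓ : ℓ ≠ 0) (y : S2) (e : E3) :
    ∫ x : S2, ⟪zonalKernel (fun t => r.eval t) x y e, surfaceCurl (polyFun p) x⟫ ∂surfaceMeasure =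
        legendreCoeff (fun t => r.eval t) ℓ * ⟪e, surfaceCurl (polyFun p) y⟫ ∧
    ∫ x : S2, ⟪zonalKernel (fun t => r.eval t) x y e, surfaceGradient (polyFun p) x⟫
        ∂surfaceMeasure =
        legendreCoeff (fun t => r.eval t) ℓ * ⟪e, surfaceGradient (polyFun p) y⟫ := by
  obtain ⟨G, hG, hκ⟩ := exists_polynomial_kappa hr
  have hy : ‖(y : E3)‖ = 1 := by simp
  -- The constant `(4π)⁻¹` is orthogonal to `P_ℓ` because `ℓ ≠ 0`; only `r` survives.
  have hcoeff : (ℓ : ℝ) * (ℓ + 1) * (2 * Real.pi * polyInt (G * legendreP ℓ)) =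
      legendreCoeff (fun t => r.eval t) ℓ := by
    have h := polyInt_primitive_mul_legendreP G ℓ
    rw [hG, sub_mul, map_sub, Polynomial.C_mul', map_smul, polyInt_legendreP, if_neg hℓ, smul_zero,
      zero_sub, neg_neg] at h
    rw [legendreCoeff_polynomial, ← h]
    ring
  have hK : ∀ᵐ x : S2 ∂surfaceMeasure, zonalKernel (fun t => r.eval t) x y e =
      surfaceCurl (fun x : E3 => G.derivative.eval ⟪x, y⟫ * ⟪x, cross e y⟫) x +
        surfaceGradient (fun x : E3 => G.derivative.eval ⟪x, y⟫ * ⟪x, e - ⟪(y : E3), e⟫ • (y : E3)⟫) x := by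
    filter_upwards [ae_inner_mem_Ioo y] with x hx
    rw [surfaceCurl_add_surfaceGradient_eq, zonalKernel, (hκ _ hx.1 hx.2).1, (hκ _ hx.1 hx.2).2]
  have hint : ∀ v : S2 → E3, Continuous v →
      ∫ x : S2, ⟪zonalKernel (fun t => r.eval t) x y e, v x⟫ ∂surfaceMeasure =
        ∫ x : S2, ⟪surfaceCurl (fun x : E3 => G.derivative.eval ⟪x, y⟫ * ⟪x, cross e y⟫) x, v x⟫
          ∂surfaceMeasure +
        ∫ x : S2, ⟪surfaceGradient
          (fun x : E3 => G.derivative.eval ⟪x, y⟫ * ⟪x, e - ⟪(y : E3), e⟫ • (y : E3)⟫) x, v x⟫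
          ∂surfaceMeasure := by
    intro v hv
    rw [← integral_inner_add (continuous_surfaceCurl (contDiff_zonal_mul_inner _ _ _))
      (continuous_surfaceGradient (contDiff_zonal_mul_inner _ _ _)) hv]
    refine integral_congr_ae ?_
    filter_upwards [hK] with x hx
    rw [hx]
  have hmom : ∀ a : E3, (ℓ : ℝ) * (ℓ + 1) * ∫ x : S2, (G.derivative.eval ⟪(x : E3), (y : E3)⟫ *
      ⟪(x : E3), cross a y⟫) * polyFun p x ∂surfaceMeasure =
      legendreCoeff (fun t => r.eval t) ℓ * ⟪cross a y, gradient (polyFun p) y⟫ := fun a => by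
    rw [← hcoeff, mul_assoc ((ℓ : ℝ) * (ℓ + 1)), ← integral_zonal_mul_inner_cross_mul_harmonic G hp hy]
    simp only [real_inner_comm]
  constructor
  · rw [hint _ (continuous_surfaceCurl_polyFun p),
      integral_surfaceGradient_surfaceCurl (contDiff_zonal_mul_inner _ _ _),
      integral_surfaceCurl_surfaceCurl (contDiff_zonal_mul_inner _ _ _) hp, hmom, add_zero]
    congr 1
    simp only [inner_eq_sum_three, surfaceCurl, cross_zero_apply, cross_one_apply, cross_two_apply]
    ring
  · rw [hint _ (continuous_surfaceGradient_polyFun p),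
      integral_surfaceCurl_surfaceGradient (contDiff_zonal_mul_inner _ _ _),
      integral_surfaceGradient_surfaceGradient (contDiff_zonal_mul_inner _ _ _) hp,
      ← cross_cross_self hy, hmom, zero_add]
    congr 1
    rw [cross_cross_self hy, surfaceGradient, inner_sub_left, inner_sub_right, inner_smul_left,
      inner_smul_right, real_inner_comm e]
    simp
    ring

lemma abs_legendreCoeff_sub_le (ℓ : ℕ) : ∃ M, 0 ≤ M ∧ ∀ {ψ₁ ψ₂ : ℝ → ℝ}, Continuous ψ₁ →
    Continuous ψ₂ → ∀ {ε : ℝ}, (∀ t ∈ Icc (-1 : ℝ) 1, |ψ₁ t - ψ₂ t| ≤ ε) →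
      |legendreCoeff ψ₁ ℓ - legendreCoeff ψ₂ ℓ| ≤ M * ε := by
  obtain ⟨C, hC⟩ := (isCompact_Icc (a := (-1 : ℝ)) (b := 1)).exists_bound_of_continuousOn
    (legendreP ℓ).continuous.continuousOn
  have hC0 : 0 ≤ C := (norm_nonneg _).trans (hC 0 (by simp))
  have hpi := Real.pi_pos
  refine ⟨4 * Real.pi * C, by positivity, fun {ψ₁ ψ₂} h₁ h₂ ε hε => ?_⟩
  have hε0 : 0 ≤ ε := (abs_nonneg _).trans (hε 0 (by simp))
  unfold legendreCoeff
  rw [← mul_sub, ← intervalIntegral.integral_sub (Continuous.intervalIntegrable (by fun_prop) _ _)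
    (Continuous.intervalIntegrable (by fun_prop) _ _), abs_mul, abs_of_pos (by positivity)]
  have h := intervalIntegral.norm_integral_le_of_norm_le_const (a := (-1 : ℝ)) (b := 1)
    (f := fun t => ψ₁ t * (legendreP ℓ).eval t - ψ₂ t * (legendreP ℓ).eval t) (C := ε * C)
    fun t ht => by
      rw [uIoc_of_le (by norm_num)] at ht
      have ht' : t ∈ Icc (-1 : ℝ) 1 := ⟨ht.1.le, ht.2⟩
      rw [← sub_mul, norm_mul]
      exact mul_le_mul (hε t ht') (hC t ht') (norm_nonneg _) hε0
  rw [Real.norm_eq_abs] at h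
  norm_num at h
  have := mul_le_mul_of_nonneg_left h (show 0 ≤ 2 * Real.pi by positivity)
  linarith

lemma integrable_inner_zonalKernel {ψ : ℝ → ℝ} (hψ : Continuous ψ)
    (hint : ∫ t in (-1 : ℝ)..1, ψ t = (2 * Real.pi)⁻¹) {v : S2 → E3} (hv : Continuous v) (y : S2)
    (e : E3) : Integrable (fun x : S2 => ⟪zonalKernel ψ x y e, v x⟫) surfaceMeasure := by
  obtain ⟨M, hM0, hM⟩ := norm_zonalKernel_le hψ hint
  obtain ⟨C, hC⟩ := isCompact_univ.exists_bound_of_continuousOn hv.continuousOn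
  have hm : Measurable fun x : S2 => zonalKernel ψ x y e :=
    measurable_zonalKernel hψ measurable_subtype_coe measurable_const measurable_const
  have hi : Measurable fun x : S2 => ⟪zonalKernel ψ x y e, v x⟫ :=
    Measurable.inner hm hv.measurable
  refine Integrable.of_bound hi.aestronglyMeasurable (M * ‖e‖ * C)
    (Filter.Eventually.of_forall fun x => ?_)
  rw [Real.norm_eq_abs]
  exact (abs_real_inner_le_norm _ _).trans
    (mul_le_mul (hM x y e) (hC x trivial) (norm_nonneg _) (by positivity))

/-- Passage from polynomial kernels to continuous kernels. -/
lemma integral_zonalKernel_of_polynomial {ψ : ℝ → ℝ} (hψ : Continuous ψ)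
    (hint : ∫ t in (-1 : ℝ)..1, ψ t = (2 * Real.pi)⁻¹) {v : S2 → E3} (hv : Continuous v) (y : S2)
    (e : E3) {ℓ : ℕ} {b : ℝ}
    (h : ∀ r : Polynomial ℝ, polyInt r = (2 * Real.pi)⁻¹ →
      ∫ x : S2, ⟪zonalKernel (fun t => r.eval t) x y e, v x⟫ ∂surfaceMeasure =
        legendreCoeff (fun t => r.eval t) ℓ * b) :
    ∫ x : S2, ⟪zonalKernel ψ x y e, v x⟫ ∂surfaceMeasure = legendreCoeff ψ ℓ * b := by
  obtain ⟨M, hM0, hM⟩ := abs_legendreCoeff_sub_le ℓ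
  obtain ⟨C, hC⟩ := isCompact_univ.exists_bound_of_continuousOn hv.continuousOn
  have hC0 : 0 ≤ C := (norm_nonneg _).trans (hC y trivial)
  have hpi := Real.pi_pos
  -- `K ε` bounds the error in the integral plus the error in the Legendre coefficient. Dividing `δ`
  -- by `K + 1` below avoids division by zero.
  set K := 12 * ‖e‖ * C * (4 * Real.pi) + M * |b| with hK
  have hK0 : 0 ≤ K := by positivity
  rw [← sub_eq_zero, ← abs_nonpos_iff]
  refine le_of_forall_pos_le_add fun δ hδ => ?_
  set ε := δ / (K + 1) with hεdef
  have hε : 0 < ε := by positivity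
  obtain ⟨r, hr, hrb⟩ := exists_polynomial_approx hψ hε
  have hr' := hr.trans hint
  have hpoly := h r hr'
  have h1 : |∫ x : S2, ⟪zonalKernel ψ x y e, v x⟫ ∂surfaceMeasure -
      ∫ x : S2, ⟪zonalKernel (fun t => r.eval t) x y e, v x⟫ ∂surfaceMeasure| ≤
      12 * ε * ‖e‖ * C * (4 * Real.pi) := by
    rw [← integral_sub (integrable_inner_zonalKernel hψ hint hv y e)
      (integrable_inner_zonalKernel r.continuous hr' hv y e), ← surfaceMeasure_real_univ]
    refine norm_integral_le_of_norm_le_const (μ := surfaceMeasure) (f := fun x : S2 =>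
      ⟪zonalKernel ψ x y e, v x⟫ - ⟪zonalKernel (fun t => r.eval t) x y e, v x⟫)
      (Filter.Eventually.of_forall fun x => ?_)
    rw [← inner_sub_left]
    exact (norm_inner_le_norm _ _).trans (mul_le_mul
      (norm_zonalKernel_sub_le hψ r.continuous hr.symm hrb x y e) (hC x trivial)
      (norm_nonneg _) (by positivity))
  have h2 : |legendreCoeff (fun t => r.eval t) ℓ * b - legendreCoeff ψ ℓ * b| ≤ M * ε * |b| := by
    rw [← sub_mul, abs_mul, abs_sub_comm]
    exact mul_le_mul_of_nonneg_right (hM hψ r.continuous hrb) (abs_nonneg _)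
  rw [hpoly] at h1
  have h3 := abs_sub_le (∫ x : S2, ⟪zonalKernel ψ x y e, v x⟫ ∂surfaceMeasure)
    (legendreCoeff (fun t => r.eval t) ℓ * b) (legendreCoeff ψ ℓ * b)
  have h4 : K * ε ≤ δ := by
    rw [hεdef, mul_div_assoc', div_le_iff₀ (by positivity)]
    nlinarith
  have h5 : 12 * ε * ‖e‖ * C * (4 * Real.pi) + M * ε * |b| = K * ε := by rw [hK]; ring
  linarith

/-- The kernel acts on surface curls of spherical harmonics by the Legendre coefficients. -/
theorem integral_zonalKernel_surfaceCurl {ψ : ℝ → ℝ} (hψ : Continuous ψ)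
    (hint : ∫ t in (-1 : ℝ)..1, ψ t = (2 * Real.pi)⁻¹) {p : MvPolynomial (Fin 3) ℝ} {ℓ : ℕ}
    (hp : p ∈ harmonicSpace ℓ) (hℓ : ℓ ≠ 0) (y : S2) (e : E3) :
    ∫ x : S2, ⟪zonalKernel ψ x y e, surfaceCurl (polyFun p) x⟫ ∂surfaceMeasure =
      legendreCoeff ψ ℓ * ⟪e, surfaceCurl (polyFun p) y⟫ :=
  integral_zonalKernel_of_polynomial hψ hint (continuous_surfaceCurl_polyFun p) y e
    fun _ hr => (integral_zonalKernel_polynomial hr hp hℓ y e).1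

/-- The kernel acts on surface gradients of spherical harmonics by the Legendre coefficients. -/
theorem integral_zonalKernel_surfaceGradient {ψ : ℝ → ℝ} (hψ : Continuous ψ)
    (hint : ∫ t in (-1 : ℝ)..1, ψ t = (2 * Real.pi)⁻¹) {p : MvPolynomial (Fin 3) ℝ} {ℓ : ℕ}
    (hp : p ∈ harmonicSpace ℓ) (hℓ : ℓ ≠ 0) (y : S2) (e : E3) :
    ∫ x : S2, ⟪zonalKernel ψ x y e, surfaceGradient (polyFun p) x⟫ ∂surfaceMeasure =
      legendreCoeff ψ ℓ * ⟪e, surfaceGradient (polyFun p) y⟫ :=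
  integral_zonalKernel_of_polynomial hψ hint (continuous_surfaceGradient_polyFun p) y e
    fun _ hr => (integral_zonalKernel_polynomial hr hp hℓ y e).2

end Eigen

/-! ### The convolution operator -/

section Convolution

lemma kernelConv_eq (ψ : ℝ → ℝ) (f : L2Field) (x : S2) :
    kernelConv ψ f x = ∫ y : S2, zonalKernel ψ x y (f y) ∂surfaceMeasure := by
  simp only [kernelConv, toLp_mulVec_eq_zonalKernel]

lemma integrable_L2Field (f : L2Field) : Integrable f surfaceMeasure :=
  (Lp.memLp f).integrable one_le_two

variable {ψ : ℝ → ℝ}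

lemma stronglyMeasurable_zonalKernel (hψ : Continuous ψ) (f : L2Field) :
    StronglyMeasurable fun z : S2 × S2 => zonalKernel ψ z.1 z.2 (f z.2) :=
  (measurable_zonalKernel hψ (measurable_subtype_coe.comp measurable_fst)
    (measurable_subtype_coe.comp measurable_snd)
    ((Lp.stronglyMeasurable f).measurable.comp measurable_snd)).stronglyMeasurable

lemma integrable_zonalKernel_right (hψ : Continuous ψ)
    (hint : ∫ t in (-1 : ℝ)..1, ψ t = (2 * Real.pi)⁻¹) (f : L2Field) (x : S2) :
    Integrable (fun y : S2 => zonalKernel ψ x y (f y)) surfaceMeasure := by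
  obtain ⟨M, hM0, hM⟩ := norm_zonalKernel_le hψ hint
  have hm : Measurable fun y : S2 => zonalKernel ψ x y (f y) :=
    measurable_zonalKernel hψ measurable_const measurable_subtype_coe
      (Lp.stronglyMeasurable f).measurable
  exact ((integrable_L2Field f).norm.const_mul M).mono' hm.aestronglyMeasurable
    (Filter.Eventually.of_forall fun y => hM x y (f y))

/-- The kernel is bounded and `L²` embeds in `L¹` on the sphere, so the convolution is a bounded
function. -/
lemma memLp_kernelConv (hψ : Continuous ψ)
    (hint : ∫ t in (-1 : ℝ)..1, ψ t = (2 * Real.pi)⁻¹) (f : L2Field) :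
    MemLp (kernelConv ψ f) 2 surfaceMeasure := by
  obtain ⟨M, hM0, hM⟩ := norm_zonalKernel_le hψ hint
  have hf : kernelConv ψ f = fun x : S2 => ∫ y : S2, zonalKernel ψ x y (f y) ∂surfaceMeasure :=
    funext (kernelConv_eq ψ f)
  rw [hf]
  refine MemLp.of_bound (StronglyMeasurable.integral_prod_right
    (stronglyMeasurable_zonalKernel hψ f)).aestronglyMeasurable
    (∫ y : S2, M * ‖f y‖ ∂surfaceMeasure) (Filter.Eventually.of_forall fun x => ?_)
  exact norm_integral_le_of_norm_le ((integrable_L2Field f).norm.const_mul M)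
    (Filter.Eventually.of_forall fun y => hM x y (f y))

lemma toLp_kernelConv_mem_tangentialL2 (hψ : Continuous ψ)
    (hint : ∫ t in (-1 : ℝ)..1, ψ t = (2 * Real.pi)⁻¹) (f : L2Field) :
    (memLp_kernelConv hψ hint f).toLp ∈ tangentialL2 := by
  change ∀ᵐ x : S2 ∂surfaceMeasure, ⟪(x : E3), (memLp_kernelConv hψ hint f).toLp _ x⟫ = 0
  filter_upwards [(memLp_kernelConv hψ hint f).coeFn_toLp] with x hx
  rw [hx, kernelConv_eq, ← integral_inner (integrable_zonalKernel_right hψ hint f x)]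
  have hx1 : ‖(x : E3)‖ = 1 := by simp
  simp only [inner_self_zonalKernel ψ hx1, integral_zero]

/-- The convolution acts on the coefficients of an eigenfield by its eigenvalue. -/
lemma integral_inner_kernelConv (hψ : Continuous ψ)
    (hint : ∫ t in (-1 : ℝ)..1, ψ t = (2 * Real.pi)⁻¹) (f : L2Field) {v : S2 → E3}
    (hv : Continuous v) {b : ℝ}
    (h : ∀ (y : S2) (e : E3), ∫ x : S2, ⟪zonalKernel ψ x y e, v x⟫ ∂surfaceMeasure = b * ⟪e, v y⟫) :
    ∫ x, ⟪(memLp_kernelConv hψ hint f).toLp _ x, v x⟫ ∂surfaceMeasure =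
      b * ∫ x, ⟪f x, v x⟫ ∂surfaceMeasure := by
  obtain ⟨M, hM0, hM⟩ := norm_zonalKernel_le hψ hint
  obtain ⟨C, hC⟩ := isCompact_univ.exists_bound_of_continuousOn hv.continuousOn
  have h1 : ∫ x, ⟪(memLp_kernelConv hψ hint f).toLp _ x, v x⟫ ∂surfaceMeasure =
      ∫ x : S2, ∫ y : S2, ⟪zonalKernel ψ x y (f y), v x⟫ ∂surfaceMeasure ∂surfaceMeasure := by
    refine integral_congr_ae ?_
    filter_upwards [(memLp_kernelConv hψ hint f).coeFn_toLp] with x hx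
    rw [hx, kernelConv_eq, real_inner_comm, ← integral_inner (integrable_zonalKernel_right hψ hint f x)]
    simp only [real_inner_comm]
  -- Joint integrability for Fubini: integrating in `x` first puts the eigenvalue relation `h` to
  -- use.
  have hI : Integrable (Function.uncurry fun x y : S2 => ⟪zonalKernel ψ x y (f y), v x⟫)
      (surfaceMeasure.prod surfaceMeasure) := by
    have hm : Measurable fun z : S2 × S2 => ⟪zonalKernel ψ z.1 z.2 (f z.2), v z.1⟫ :=
      Measurable.inner (stronglyMeasurable_zonalKernel hψ f).measurable
        (hv.measurable.comp measurable_fst)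
    refine (((integrable_L2Field f).norm.const_mul (M * C)).comp_snd surfaceMeasure).mono'
      hm.aestronglyMeasurable (Filter.Eventually.of_forall fun z => ?_)
    simp only [Function.uncurry, Real.norm_eq_abs]
    refine (abs_real_inner_le_norm _ _).trans ?_
    calc _ ≤ M * ‖f z.2‖ * C := mul_le_mul (hM z.1 z.2 (f z.2)) (hC z.1 trivial) (norm_nonneg _)
          (by positivity)
      _ = _ := by ring
  rw [h1, integral_integral_swap hI]
  simp only [h, integral_const_mul]

end Convolution

/-! ### The Helmholtz–Hodge projections on vector spherical harmonics -/

section Hodge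

lemma toLp_surfaceCurl_mem_divFree (p : MvPolynomial (Fin 3) ℝ) :
    (memLp_of_continuous (continuous_surfaceCurl_polyFun p)).toLp _ ∈ divFree := by
  have hae := (memLp_of_continuous (continuous_surfaceCurl_polyFun p)).coeFn_toLp
  refine ⟨?_, fun g hg => ?_⟩
  · filter_upwards [hae] with x hx
    rw [hx, inner_eq_sum_three, surfaceCurl, cross_zero_apply, cross_one_apply, cross_two_apply]
    ring
  · rw [← integral_surfaceGradient_surfaceCurl (hg.of_le (by simp)) p]
    refine integral_congr_ae ?_
    filter_upwards [hae] with x hx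
    rw [hx, real_inner_comm]

lemma toLp_surfaceGradient_mem_curlFree (p : MvPolynomial (Fin 3) ℝ) :
    (memLp_of_continuous (continuous_surfaceGradient_polyFun p)).toLp _ ∈ curlFree := by
  have hae := (memLp_of_continuous (continuous_surfaceGradient_polyFun p)).coeFn_toLp
  refine ⟨?_, fun g hg => ?_⟩
  · filter_upwards [hae] with x hx
    have hx1 : ‖(x : E3)‖ = 1 := by simp
    rw [hx, surfaceGradient, inner_sub_right, inner_smul_right, real_inner_self_eq_norm_sq, hx1]
    ring
  · rw [← integral_surfaceCurl_surfaceGradient (hg.of_le (by simp)) p]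
    refine integral_congr_ae ?_
    filter_upwards [hae] with x hx
    rw [hx, real_inner_comm]

lemma divPart_mem (f : L2Field) : divPart f ∈ divFree := Submodule.starProjection_apply_mem _ _

lemma curlPart_mem (f : L2Field) : curlPart f ∈ curlFree := Submodule.starProjection_apply_mem _ _

/-- The orthogonal projection is self-adjoint and fixes surface curls. -/
lemma integral_divPart_surfaceCurl (f : L2Field) (p : MvPolynomial (Fin 3) ℝ) :
    ∫ x, ⟪divPart f x, surfaceCurl (polyFun p) x⟫ ∂surfaceMeasure =
      ∫ x, ⟪f x, surfaceCurl (polyFun p) x⟫ ∂surfaceMeasure := by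
  rw [integral_inner_eq _ (continuous_surfaceCurl_polyFun p),
    integral_inner_eq _ (continuous_surfaceCurl_polyFun p), divPart,
    Submodule.inner_starProjection_left_eq_right,
    Submodule.starProjection_eq_self_iff.2 (toLp_surfaceCurl_mem_divFree p)]

lemma integral_curlPart_surfaceGradient (f : L2Field) (p : MvPolynomial (Fin 3) ℝ) :
    ∫ x, ⟪curlPart f x, surfaceGradient (polyFun p) x⟫ ∂surfaceMeasure =
      ∫ x, ⟪f x, surfaceGradient (polyFun p) x⟫ ∂surfaceMeasure := by
  rw [integral_inner_eq _ (continuous_surfaceGradient_polyFun p),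
    integral_inner_eq _ (continuous_surfaceGradient_polyFun p), curlPart,
    Submodule.inner_starProjection_left_eq_right,
    Submodule.starProjection_eq_self_iff.2 (toLp_surfaceGradient_mem_curlFree p)]

variable (Y : (ℓ : ℕ) → Fin (2 * ℓ + 1) → MvPolynomial (Fin 3) ℝ)

lemma divCoeff_eq (f : L2Field) (ℓ : ℕ) (k : Fin (2 * ℓ + 1)) : divCoeff Y f ℓ k =
    (√((ℓ : ℝ) * (ℓ + 1)))⁻¹ * ∫ x, ⟪f x, surfaceCurl (polyFun (Y ℓ k)) x⟫ ∂surfaceMeasure := by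
  simp only [divCoeff, vecY, inner_smul_right, integral_const_mul]

lemma curlCoeff_eq (f : L2Field) (ℓ : ℕ) (k : Fin (2 * ℓ + 1)) : curlCoeff Y f ℓ k =
    (√((ℓ : ℝ) * (ℓ + 1)))⁻¹ * ∫ x, ⟪f x, surfaceGradient (polyFun (Y ℓ k)) x⟫ ∂surfaceMeasure := by
  simp only [curlCoeff, vecZ, inner_smul_right, integral_const_mul]

lemma divCoeff_sub (f g : L2Field) (ℓ : ℕ) (k : Fin (2 * ℓ + 1)) :
    divCoeff Y (f - g) ℓ k = divCoeff Y f ℓ k - divCoeff Y g ℓ k := by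
  simp only [divCoeff_eq, integral_inner_eq _ (continuous_surfaceCurl_polyFun _), inner_sub_left]
  ring

lemma curlCoeff_sub (f g : L2Field) (ℓ : ℕ) (k : Fin (2 * ℓ + 1)) :
    curlCoeff Y (f - g) ℓ k = curlCoeff Y f ℓ k - curlCoeff Y g ℓ k := by
  simp only [curlCoeff_eq, integral_inner_eq _ (continuous_surfaceGradient_polyFun _), inner_sub_left]
  ring

lemma divCoeff_divPart (f : L2Field) (ℓ : ℕ) (k : Fin (2 * ℓ + 1)) :
    divCoeff Y (divPart f) ℓ k = divCoeff Y f ℓ k := by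
  rw [divCoeff_eq, divCoeff_eq, integral_divPart_surfaceCurl]

/-- The polynomial `Y ℓ k` is itself one of the smooth test functions in the definition of
`divFree`. -/
lemma curlCoeff_divPart (f : L2Field) (ℓ : ℕ) (k : Fin (2 * ℓ + 1)) :
    curlCoeff Y (divPart f) ℓ k = 0 := by
  rw [curlCoeff_eq, (divPart_mem f).2 _ (contDiff_polyFun _), mul_zero]

lemma curlCoeff_curlPart (f : L2Field) (ℓ : ℕ) (k : Fin (2 * ℓ + 1)) :
    curlCoeff Y (curlPart f) ℓ k = curlCoeff Y f ℓ k := by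
  rw [curlCoeff_eq, curlCoeff_eq, integral_curlPart_surfaceGradient]

lemma divCoeff_curlPart (f : L2Field) (ℓ : ℕ) (k : Fin (2 * ℓ + 1)) :
    divCoeff Y (curlPart f) ℓ k = 0 := by
  rw [divCoeff_eq, (curlPart_mem f).2 _ (contDiff_polyFun _), mul_zero]

variable {Y} {ψ : ℝ → ℝ}

lemma IsSphericalHarmonicBasis.mem_harmonicSpace (hY : IsSphericalHarmonicBasis Y) (ℓ : ℕ)
    (k : Fin (2 * ℓ + 1)) : Y ℓ k ∈ harmonicSpace ℓ := by
  rw [← hY.span_eq]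
  exact Submodule.subset_span ⟨k, rfl⟩

lemma divCoeff_kernelConv (hY : IsSphericalHarmonicBasis Y) (hψ : Continuous ψ)
    (hint : ∫ t in (-1 : ℝ)..1, ψ t = (2 * Real.pi)⁻¹) (f : L2Field) {ℓ : ℕ} (hℓ : ℓ ≠ 0)
    (k : Fin (2 * ℓ + 1)) : divCoeff Y (memLp_kernelConv hψ hint f).toLp ℓ k =
      legendreCoeff ψ ℓ * divCoeff Y f ℓ k := by
  rw [divCoeff_eq, divCoeff_eq, integral_inner_kernelConv hψ hint f
    (continuous_surfaceCurl_polyFun _)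
    (integral_zonalKernel_surfaceCurl hψ hint (hY.mem_harmonicSpace ℓ k) hℓ)]
  ring

lemma curlCoeff_kernelConv (hY : IsSphericalHarmonicBasis Y) (hψ : Continuous ψ)
    (hint : ∫ t in (-1 : ℝ)..1, ψ t = (2 * Real.pi)⁻¹) (f : L2Field) {ℓ : ℕ} (hℓ : ℓ ≠ 0)
    (k : Fin (2 * ℓ + 1)) : curlCoeff Y (memLp_kernelConv hψ hint f).toLp ℓ k =
      legendreCoeff ψ ℓ * curlCoeff Y f ℓ k := by
  rw [curlCoeff_eq, curlCoeff_eq, integral_inner_kernelConv hψ hint f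
    (continuous_surfaceGradient_polyFun _)
    (integral_zonalKernel_surfaceGradient hψ hint (hY.mem_harmonicSpace ℓ k) hℓ)]
  ring

/-- Comparison of Sobolev norms from a comparison of coefficients. -/
lemma sobolevNorm_le_mul {σ τ K : ℝ} (hK : 0 ≤ K) {f g : L2Field}
    (h : ∀ (ℓ : ℕ), ℓ ≠ 0 → ∀ k : Fin (2 * ℓ + 1),
      (1 + (ℓ : ℝ) * (ℓ + 1)) ^ τ * (divCoeff Y g ℓ k ^ 2 + curlCoeff Y g ℓ k ^ 2) ≤
        K ^ 2 * ((1 + (ℓ : ℝ) * (ℓ + 1)) ^ σ * (divCoeff Y f ℓ k ^ 2 + curlCoeff Y f ℓ k ^ 2))) :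
    sobolevNorm Y τ g ≤ ENNReal.ofReal K * sobolevNorm Y σ f := by
  have hK2 : ENNReal.ofReal K = ENNReal.ofReal (K ^ 2) ^ (1 / 2 : ℝ) := by
    rw [ENNReal.ofReal_rpow_of_nonneg (by positivity) (by norm_num), ← Real.sqrt_eq_rpow,
      Real.sqrt_sq hK]
  unfold sobolevNorm
  rw [hK2, ← ENNReal.mul_rpow_of_nonneg _ _ (by norm_num), ← ENNReal.tsum_mul_left]
  refine ENNReal.rpow_le_rpow (ENNReal.tsum_le_tsum fun ℓ => ?_) (by norm_num)
  rw [Finset.mul_sum]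
  refine Finset.sum_le_sum fun k _ => ?_
  rw [← ENNReal.ofReal_mul (by positivity)]
  exact ENNReal.ofReal_le_ofReal (h ℓ (Nat.one_le_iff_ne_zero.1 ℓ.2) k)

end Hodge

/-! ### Bounds for the Legendre coefficients of scaled kernels -/

section Multiplier

/-- Replaces `φ`, continuous only on `[0, ∞)`, by a globally continuous function that agrees with it
at the nonnegative arguments used. -/
lemma continuous_comp_max {φ : ℝ → ℝ} (hφ : ContinuousOn φ (Ici 0)) :
    Continuous fun u => φ (max 0 u) :=
  hφ.comp_continuous (by fun_prop) fun u => le_max_left 0 u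

lemma scaledKernel_eq (φ : ℝ → ℝ) (a : ℝ) {ρ : ℝ} (hρ : 0 < ρ) :
    scaledKernel φ a ρ = fun t => a * φ (max 0 (ρ⁻¹ * √(2 - 2 * t))) := by
  ext t
  rw [scaledKernel, max_eq_right (by positivity)]

lemma continuous_scaledKernel {φ : ℝ → ℝ} (hφ : ContinuousOn φ (Ici 0)) (a : ℝ) {ρ : ℝ}
    (hρ : 0 < ρ) : Continuous (scaledKernel φ a ρ) := by
  rw [scaledKernel_eq φ a hρ]
  exact continuous_const.mul ((continuous_comp_max hφ).comp (by fun_prop))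

lemma integral_scaledKernel {φ : ℝ → ℝ} (hφ : ContinuousOn φ (Ici 0)) {a ρ : ℝ} (hρ : 0 < ρ)
    (h : ∀ y : S2, ∫ x : S2, scaledKernel φ a ρ ⟪(x : E3), (y : E3)⟫ ∂surfaceMeasure = 1) :
    ∫ t in (-1 : ℝ)..1, scaledKernel φ a ρ t = (2 * Real.pi)⁻¹ := by
  have h1 := h ⟨EuclideanSpace.single 0 1, by simp⟩
  rw [integral_zonal (continuous_scaledKernel hφ a hρ)] at h1
  exact eq_inv_of_mul_eq_one_right h1

/-- The scaled kernels are uniformly bounded for scales in a compact subset of `(0, 1)`. -/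
lemma exists_bound_scaledKernel {φ : ℝ → ℝ} (hφ : ContinuousOn φ (Ici 0)) {c : ℝ → ℝ}
    (hc : ∀ ρ : ℝ, 0 < ρ → ρ < 1 → ∀ y : S2,
      ∫ x : S2, scaledKernel φ (c ρ) ρ ⟪(x : E3), (y : E3)⟫ ∂surfaceMeasure = 1)
    {ρ₀ ρ₁ : ℝ} (hρ₀ : 0 < ρ₀) (hρ₁ : ρ₁ < 1) :
    ∃ K, 0 ≤ K ∧ ∀ ρ ∈ Icc ρ₀ ρ₁, ∀ t ∈ Icc (-1 : ℝ) 1, |scaledKernel φ (c ρ) ρ t| ≤ K := by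
  have hφ' := continuous_comp_max hφ
  set J : ℝ → ℝ := fun ρ => ∫ t in (-1 : ℝ)..1, φ (max 0 (ρ⁻¹ * √(2 - 2 * t))) with hJ
  have hJc : ContinuousOn J (Ioi 0) := by
    have h1 : Continuous fun u : ℝ => ∫ t in (-1 : ℝ)..1, φ (max 0 (u * √(2 - 2 * t))) :=
      intervalIntegral.continuous_parametric_intervalIntegral_of_continuous'
        (f := fun u t : ℝ => φ (max 0 (u * √(2 - 2 * t))))
        (hφ'.comp (by fun_prop : Continuous fun z : ℝ × ℝ => z.1 * √(2 - 2 * z.2))) _ _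
    exact h1.comp_continuousOn (continuousOn_inv₀.mono fun ρ hρ => (ne_of_gt hρ : ρ ≠ 0))
  -- The normalisation forces `J ρ ≠ 0` and determines `c ρ` from it. Continuity of `J` thus bounds
  -- `c` on compact ranges, although no regularity of `c` is assumed.
  have hcJ : ∀ ρ, 0 < ρ → ρ < 1 → c ρ * J ρ = (2 * Real.pi)⁻¹ := fun ρ h1 h2 => by
    rw [← integral_scaledKernel hφ h1 (hc ρ h1 h2), scaledKernel_eq φ _ h1,
      intervalIntegral.integral_const_mul]
  have hpos : ∀ ρ ∈ Icc ρ₀ ρ₁, 0 < ρ ∧ ρ < 1 := fun ρ h => ⟨hρ₀.trans_le h.1, h.2.trans_lt hρ₁⟩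
  have hJ0 : ∀ ρ ∈ Icc ρ₀ ρ₁, J ρ ≠ 0 := fun ρ h h0 => by
    have := hcJ ρ (hpos ρ h).1 (hpos ρ h).2
    rw [h0, mul_zero] at this
    exact (inv_ne_zero (by positivity : 2 * Real.pi ≠ 0)) this.symm
  obtain ⟨A, hA⟩ := isCompact_Icc.exists_bound_of_continuousOn
    ((hJc.mono fun ρ h => (hpos ρ h).1).inv₀ hJ0)
  have hg : ContinuousOn (fun z : ℝ × ℝ => φ (max 0 (z.1⁻¹ * √(2 - 2 * z.2))))
      (Icc ρ₀ ρ₁ ×ˢ Icc (-1 : ℝ) 1) := by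
    refine hφ'.comp_continuousOn (ContinuousOn.mul ?_ (by fun_prop))
    exact continuousOn_fst.inv₀ fun z hz => (hpos z.1 hz.1).1.ne'
  obtain ⟨B, hB⟩ := (isCompact_Icc.prod isCompact_Icc).exists_bound_of_continuousOn hg
  refine ⟨|(2 * Real.pi)⁻¹ * A * B|, abs_nonneg _, fun ρ hρ t ht => ?_⟩
  have h1 := hA ρ hρ
  have h2 := hB (ρ, t) ⟨hρ, ht⟩
  have hcρ : c ρ = (2 * Real.pi)⁻¹ * (J ρ)⁻¹ := by
    rw [← hcJ ρ (hpos ρ hρ).1 (hpos ρ hρ).2, mul_assoc, mul_inv_cancel₀ (hJ0 ρ hρ), mul_one]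
  rw [scaledKernel_eq φ _ (hpos ρ hρ).1, hcρ]
  rw [Real.norm_eq_abs] at h1 h2
  rw [abs_mul, abs_mul, abs_mul, abs_mul]
  exact mul_le_mul (mul_le_mul_of_nonneg_left (h1.trans (le_abs_self A)) (abs_nonneg _))
    (h2.trans (le_abs_self B)) (abs_nonneg _) (by positivity)

/-- The multiplier estimate for the symbol of the convolution. -/
lemma exists_multiplier_bound {φ : ℝ → ℝ} (hφ : ContinuousOn φ (Ici 0)) {c : ℝ → ℝ}
    (hc : ∀ ρ : ℝ, 0 < ρ → ρ < 1 → ∀ y : S2,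
      ∫ x : S2, scaledKernel φ (c ρ) ρ ⟪(x : E3), (y : E3)⟫ ∂surfaceMeasure = 1)
    {ρ₀ m c₁ c₂ : ℝ} (hρ₀ : 0 < ρ₀) (hc₁ : 0 < c₁) (hc₂ : 0 < c₂)
    (hker : KernelAssumption (fun ρ => scaledKernel φ (c ρ) ρ) ρ₀ m c₁ c₂)
    {s : ℝ} (hs : 0 ≤ s) (hsm : s ≤ m) :
    ∃ C, 0 < C ∧ ∀ ρ, 0 < ρ → ρ < 1 → ∀ ℓ : ℕ, ℓ ≠ 0 →
      |1 - legendreCoeff (scaledKernel φ (c ρ) ρ) ℓ| ≤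
        C * (ρ * √(1 + (ℓ : ℝ) * (ℓ + 1))) ^ s := by
  -- The upper limit `1 / 2` suffices: `1 ≤ ℓ ≤ ρ⁻¹ - 1` already forces `ρ ≤ 1 / 2`.
  obtain ⟨K, hK0, hK⟩ := exists_bound_scaledKernel hφ hc hρ₀ (ρ₁ := 1 / 2) (by norm_num)
  choose M hM0 hM using abs_legendreCoeff_sub_le
  set N := ⌊ρ₀⁻¹⌋₊
  set B := ∑ ℓ ∈ Finset.range (N + 1), M ℓ * K with hBdef
  have hB0 : 0 ≤ B := Finset.sum_nonneg fun ℓ _ => mul_nonneg (hM0 ℓ) hK0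
  have hr0 : 0 < ρ₀ ^ s := Real.rpow_pos_of_pos hρ₀ s
  -- One summand for each regime: `ℓ > ℓ_ρ`; then `ℓ ≤ ℓ_ρ` with `ρ < ρ₀`; then `ℓ ≤ ℓ_ρ` with `ρ ≥
  -- ρ₀`.
  refine ⟨(1 + c₂) * 2 ^ s + c₁ + (1 + B) * (ρ₀ ^ s)⁻¹, by positivity, fun ρ h0 h1 ℓ hℓ => ?_⟩
  set w := √(1 + (ℓ : ℝ) * (ℓ + 1)) with hw
  have hℓ1 : (1 : ℝ) ≤ ℓ := by exact_mod_cast Nat.one_le_iff_ne_zero.2 hℓ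
  have hw1 : 1 ≤ w := Real.one_le_sqrt.2 (by nlinarith)
  have hwℓ : (ℓ : ℝ) ≤ w := Real.le_sqrt_of_sq_le (by nlinarith)
  have hX : 0 < ρ * w := by positivity
  have hXs : 0 < (ρ * w) ^ s := Real.rpow_pos_of_pos hX s
  have p1 : 0 ≤ (1 + c₂) * 2 ^ s * (ρ * w) ^ s := by positivity
  have p2 : 0 ≤ c₁ * (ρ * w) ^ s := by positivity
  have p3 : 0 ≤ (1 + B) * (ρ₀ ^ s)⁻¹ * (ρ * w) ^ s := by positivity
  rw [add_mul, add_mul]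
  rcases lt_or_ge ⌊ρ⁻¹ - 1⌋₊ ℓ with hℓρ | hℓρ
  · have hh := hker.high ρ h0 h1 ℓ hℓρ
    have h2 : ρ⁻¹ - 1 < ℓ := (Nat.lt_floor_add_one _).trans_le (by exact_mod_cast hℓρ)
    -- In the high range `ρ⁻¹ < ℓ + 1 ≤ 2w`, so the claimed bound is at least a constant.
    have h3 : 1 ≤ 2 * (ρ * w) := by
      have h4 : ρ⁻¹ ≤ 2 * w := by linarith
      rw [inv_le_iff_one_le_mul₀ h0] at h4
      linarith
    have h5 : 1 ≤ 2 ^ s * (ρ * w) ^ s := by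
      rw [← Real.mul_rpow zero_le_two hX.le]
      exact Real.one_le_rpow h3 hs
    have h6 : |1 - legendreCoeff (scaledKernel φ (c ρ) ρ) ℓ| ≤ 1 + c₂ :=
      (abs_sub _ _).trans (by rw [abs_one]; gcongr)
    have h7 := mul_le_mul_of_nonneg_left h5 (show 0 ≤ 1 + c₂ by positivity)
    linarith
  · have hρinv : 1 ≤ ρ⁻¹ := (one_le_inv₀ h0).2 h1.le
    have h2 : (ℓ : ℝ) ≤ ρ⁻¹ - 1 :=
      (Nat.cast_le.2 hℓρ).trans (Nat.floor_le (by linarith))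
    rcases lt_or_ge ρ ρ₀ with hρ | hρ
    · have hl := hker.low ρ h0 hρ ℓ hℓρ
      have h3 : (ℓ : ℝ) * ρ ≤ 1 := by
        have := mul_le_mul_of_nonneg_right h2 h0.le
        rw [sub_mul, inv_mul_cancel₀ h0.ne'] at this
        linarith
      -- As `ℓρ ≤ 1`, lowering the exponent from `m` to `s` only increases the power.
      have h4 : ((ℓ : ℝ) * ρ) ^ m ≤ (ρ * w) ^ s :=
        (Real.rpow_le_rpow_of_exponent_ge (by positivity) h3 hsm).trans
          (Real.rpow_le_rpow (by positivity) (by rw [mul_comm]; gcongr) hs)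
      have h5 := mul_le_mul_of_nonneg_left h4 hc₁.le
      linarith
    -- For `ρ ≥ ρ₀` only the finitely many degrees `ℓ ≤ ρ₀⁻¹` occur, and uniformly bounded kernels
    -- have uniformly bounded coefficients there.
    · have hρ2 : ρ ≤ 1 / 2 := by
        have : 2 ≤ ρ⁻¹ := by linarith
        rw [le_inv_comm₀ two_pos h0] at this
        linarith
      have hℓN : ℓ ∈ Finset.range (N + 1) := by
        rw [Finset.mem_range, Nat.lt_succ_iff]
        refine Nat.le_floor ?_
        have : ρ⁻¹ ≤ ρ₀⁻¹ := inv_anti₀ hρ₀ hρ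
        linarith
      have h3 : |legendreCoeff (scaledKernel φ (c ρ) ρ) ℓ| ≤ B := by
        have h4 := hM ℓ (continuous_scaledKernel hφ (c ρ) h0) (continuous_const (y := (0 : ℝ)))
          (ε := K) fun t ht => by simpa using hK ρ ⟨hρ, hρ2⟩ t ht
        have h5 : legendreCoeff (fun _ => 0) ℓ = 0 := by simp [legendreCoeff]
        rw [h5, sub_zero] at h4
        exact h4.trans (Finset.single_le_sum (f := fun ℓ => M ℓ * K)
          (fun i _ => mul_nonneg (hM0 i) hK0) hℓN)
      have h6 : |1 - legendreCoeff (scaledKernel φ (c ρ) ρ) ℓ| ≤ 1 + B :=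
        (abs_sub _ _).trans (by rw [abs_one]; gcongr)
      have h7 : 1 ≤ (ρ₀ ^ s)⁻¹ * (ρ * w) ^ s := by
        rw [inv_mul_eq_div, one_le_div hr0]
        exact Real.rpow_le_rpow hρ₀.le (hρ.trans (le_mul_of_one_le_right h0.le hw1)) hs
      have h8 := mul_le_mul_of_nonneg_left h7 (show 0 ≤ 1 + B by positivity)
      linarith

end Multiplier

theorem mainTheorem4
    (Y : (ℓ : ℕ) → Fin (2 * ℓ + 1) → MvPolynomial (Fin 3) ℝ) (hY : IsSphericalHarmonicBasis Y)
    -- the scaled zonal kernels, with their normalising constants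
    (φ : ℝ → ℝ) (hφ : ContinuousOn φ (Set.Ici 0)) (c : ℝ → ℝ)
    (hc : ∀ ρ : ℝ, 0 < ρ → ρ < 1 → ∀ y : S2,
      ∫ x : S2, scaledKernel φ (c ρ) ρ ⟪(x : E3), (y : E3)⟫ ∂surfaceMeasure = 1)
    (ρ₀ m c₁ c₂ : ℝ) (hρ₀ : 0 < ρ₀) (hρ₀' : ρ₀ < 1) (hm : 0 ≤ m) (hc₁ : 0 < c₁) (hc₂ : 0 < c₂)
    (hker : KernelAssumption (fun ρ => scaledKernel φ (c ρ) ρ) ρ₀ m c₁ c₂)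
    (σ τ : ℝ) (hσm : σ ≤ m) (hτ : 0 ≤ τ) (hτσ : τ ≤ σ) :
    ∃ C : ℝ, 0 < C ∧ ∀ ρ : ℝ, 0 < ρ → ρ < 1 → ∀ f : L2Field, MemSobolev Y σ f →
      ∃ hC : MemLp (kernelConv (scaledKernel φ (c ρ) ρ) f) 2 surfaceMeasure,
        hC.toLp ∈ tangentialL2 ∧
        sobolevNorm Y τ (divPart f - divPart hC.toLp) ≤
          ENNReal.ofReal (C * ρ ^ (σ - τ)) * sobolevNorm Y σ f ∧
        sobolevNorm Y τ (curlPart f - curlPart hC.toLp) ≤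
          ENNReal.ofReal (C * ρ ^ (σ - τ)) * sobolevNorm Y σ f := by
  obtain ⟨C, hC0, hC⟩ := exists_multiplier_bound hφ hc hρ₀ hc₁ hc₂ hker (s := σ - τ)
    (by linarith) (by linarith)
  refine ⟨C, hC0, fun ρ h0 h1 f _ => ?_⟩
  have hψ := continuous_scaledKernel hφ (c ρ) h0
  have hint := integral_scaledKernel hφ h0 (hc ρ h0 h1)
  have hK : 0 ≤ C * ρ ^ (σ - τ) := by positivity
  -- The factor `(1 + ℓ(ℓ+1))^(σ-τ)` from the squared multiplier raises the weight from `τ` to `σ`.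
  -- Here `a` is the coefficient of the part being estimated and `b` the other one, which only
  -- enlarges the right-hand side.
  have key : ∀ ℓ : ℕ, ℓ ≠ 0 → ∀ a b : ℝ, (1 + (ℓ : ℝ) * (ℓ + 1)) ^ τ *
      ((a - legendreCoeff (scaledKernel φ (c ρ) ρ) ℓ * a) ^ 2) ≤
      (C * ρ ^ (σ - τ)) ^ 2 * ((1 + (ℓ : ℝ) * (ℓ + 1)) ^ σ * (a ^ 2 + b ^ 2)) := by
    intro ℓ hℓ a b
    have h2 := hC ρ h0 h1 ℓ hℓ
    have hw : 0 < 1 + (ℓ : ℝ) * (ℓ + 1) := by positivity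
    rw [Real.mul_rpow h0.le (Real.sqrt_nonneg _), ← mul_assoc] at h2
    have h3 := pow_le_pow_left₀ (abs_nonneg _) h2 2
    have h4 : (√(1 + (ℓ : ℝ) * (ℓ + 1)) ^ (σ - τ)) ^ 2 = (1 + (ℓ : ℝ) * (ℓ + 1)) ^ (σ - τ) := by
      rw [sq, ← Real.mul_rpow (Real.sqrt_nonneg _) (Real.sqrt_nonneg _), Real.mul_self_sqrt hw.le]
    rw [sq_abs, mul_pow, h4] at h3
    have h5 : (1 + (ℓ : ℝ) * (ℓ + 1)) ^ τ * (1 + (ℓ : ℝ) * (ℓ + 1)) ^ (σ - τ) =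
        (1 + (ℓ : ℝ) * (ℓ + 1)) ^ σ := by
      rw [← Real.rpow_add hw]; congr 1; ring
    have h6 : 0 ≤ (1 + (ℓ : ℝ) * (ℓ + 1)) ^ τ := by positivity
    have h7 : 0 ≤ (1 + (ℓ : ℝ) * (ℓ + 1)) ^ σ := by positivity
    calc _ = (1 + (ℓ : ℝ) * (ℓ + 1)) ^ τ *
          (1 - legendreCoeff (scaledKernel φ (c ρ) ρ) ℓ) ^ 2 * a ^ 2 := by ring
      _ ≤ (1 + (ℓ : ℝ) * (ℓ + 1)) ^ τ *
          ((C * ρ ^ (σ - τ)) ^ 2 * (1 + (ℓ : ℝ) * (ℓ + 1)) ^ (σ - τ)) * a ^ 2 := by gcongr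
      _ = (C * ρ ^ (σ - τ)) ^ 2 * ((1 + (ℓ : ℝ) * (ℓ + 1)) ^ σ * a ^ 2) := by rw [← h5]; ring
      _ ≤ _ := by gcongr; nlinarith [sq_nonneg b]
  refine ⟨memLp_kernelConv hψ hint f, toLp_kernelConv_mem_tangentialL2 hψ hint f,
    sobolevNorm_le_mul hK fun ℓ hℓ k => ?_, sobolevNorm_le_mul hK fun ℓ hℓ k => ?_⟩
  · rw [divCoeff_sub, curlCoeff_sub, divCoeff_divPart, divCoeff_divPart, curlCoeff_divPart,
      curlCoeff_divPart, divCoeff_kernelConv hY hψ hint f hℓ]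
    simpa using key ℓ hℓ (divCoeff Y f ℓ k) (curlCoeff Y f ℓ k)
  · rw [divCoeff_sub, curlCoeff_sub, divCoeff_curlPart, divCoeff_curlPart, curlCoeff_curlPart,
      curlCoeff_curlPart, curlCoeff_kernelConv hY hψ hint f hℓ]
    simpa [add_comm] using key ℓ hℓ (curlCoeff Y f ℓ k) (divCoeff Y f ℓ k)
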